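/- Let $\mathbb{K}$ be a field of characteristic zero. For a finite group $G$ let $R_\mathbb{K}(G)$ be the ring of virtual characters of $G$ over $\mathbb{K}$ (the Grothendieck ring of finite-dimensional $\mathbb{K}G$-modules), with the $\lambda$-operations determined by exterior powers, that is, $\lambda^n([V])=[\Lambda^n V]$ and $\lambda_t(x+y)=\lambda_t(x)\lambda_t(y)$ for $\lambda_t(x)=\sum_n\lambda^n(x)t^n$. Put $\gamma^n(x)=\lambda^n(x+n-1)$, and let $I$ be the kernel of the degree map $R_\mathbb{K}(G)\to\mathbb{Z}$. The Grothendieck filtration $\Gamma^n(G)\subseteq R_\mathbb{K}(G)$ is the additive subgroup generated by all monomials $\gamma^{n_1}(x_1)\cdots\gamma^{n_k}(x_k)$ with $x_i\in I$ and $n_1+\dots+n_k\ge n$. The saturated filtration is $$F^n(G)=\sum_{H\le G}\operatorname{Ind}_H^G(\Gamma^n(H)),\qquad n\ge 0 .$$ Theorem. Let $G$ be a finite group. For every subgroup $H\le G$, one has $F^0(H)=R_\mathbb{K}(H)$, $F^{n+1}(H)\subseteq F^n(H)$ and $F^m(H)F^n(H)\subseteq F^{m+n}(H)$ for all $m,n$,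 so that multiplication in $R_\mathbb{K}(H)$ induces a multiplication on the saturated graded ring $$\mathcal{R}^*_\mathbb{K}(H)=\bigoplus_{n\ge 0}F^n(H)/F^{n+1}(H).$$ For all subgroups $L\le H\le G$ and $g\in G$, the restriction $R_\mathbb{K}(H)\to R_\mathbb{K}(L)$, the induction $R_\mathbb{K}(L)\to R_\mathbb{K}(H)$ and the conjugation $c_g\colon R_\mathbb{K}(H)\to R_\mathbb{K}({}^gH)$, $(c_g\chi)(y)=\chi(g^{-1}yg)$, where ${}^gH=gHg^{-1}$, map $F^n$ into $F^n$ for every $n\ge0$. With the induced homomorphisms $\operatorname{res}^H_L$, $\operatorname{ind}_L^H$, $c_g$ of graded groups, $\mathcal{R}^*_\mathbb{K}(-)$ is a Mackey functor on the subgroups of $G$ with values in abelian groups. Explicitly: 1. $\operatorname{res}^H_H$, $\operatorname{ind}^H_H$, and $c_h$ on $\mathcal{R}^*_\mathbb{K}(H)$ for $h\in H$, are identities; 2. $\operatorname{res}^L_J\operatorname{res}^H_L=\operatorname{res}^H_J$ and $\operatorname{ind}^H_L\operatorname{ind}^L_J=\operatorname{ind}^H_J$ for $J\le L\le H$; 3.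 $c_gc_h=c_{gh}$ for $g,h\in G$; 4. $\operatorname{res}^{{}^gH}_{{}^gL}c_g=c_g\operatorname{res}^H_L$ and $\operatorname{ind}^{{}^gH}_{{}^gL}c_g=c_g\operatorname{ind}^H_L$ for $L\le H$ and $g\in G$; 5. for $J,L\le H$, $$\operatorname{res}^H_J\operatorname{ind}^H_L=\sum_{x\in[J\backslash H/L]}\operatorname{ind}^J_{J\cap{}^xL}\,c_x\,\operatorname{res}^L_{{}^{x^{-1}}J\cap L},$$ where $[J\backslash H/L]\subseteq H$ is any set of representatives of the double cosets. -/

import Mathlib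

namespace SaturatedRing

universe u v w

/-! ### Exterior powers and traces -/

section LinearAlgebra

open Polynomial

theorem det_aeval_eq {L n : Type*} [Field L] [IsAlgClosed L] [Fintype n] [DecidableEq n]
    (A : Matrix n n L) (p : L[X]) :
    (aeval A p).det = (A.charpoly.roots.map fun a => p.eval a).prod := by
  have hs : A.charpoly = (A.charpoly.roots.map fun a => X - C a).prod :=
    (IsAlgClosed.splits A.charpoly).eq_prod_roots_of_monic A.charpoly_monic
  have hc : A.charpoly.roots.card = Fintype.card n := by
    rw [← (IsAlgClosed.splits A.charpoly).natDegree_eq_card_roots, A.charpoly_natDegree_eq_dim]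
  have h1 : ∀ a : L, (aeval A (X - C a)).det
      = (A.charpoly.roots.map fun b => (X - C a).eval b).prod := by
    intro a
    have h2 : (aeval A (X - C a)) = -(Matrix.scalar n a - A) := by
      simp [Algebra.algebraMap_eq_smul_one, Matrix.smul_one_eq_diagonal]
    have h4 : (Matrix.scalar n a - A).det = (A.charpoly.roots.map fun b => a - b).prod := by
      rw [← Matrix.eval_charpoly]
      conv_lhs => rw [hs]
      rw [eval_multiset_prod, Multiset.map_map]
      simp
    rw [h2, Matrix.det_neg, h4, ← hc, ← Multiset.card_map (fun b => a - b),
      ← Multiset.prod_map_neg, Multiset.map_map]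
    simp
  have h3 := (IsAlgClosed.splits p).eq_prod_roots
  generalize p.roots = r at h3
  generalize p.leadingCoeff = c at h3
  subst h3
  induction r using Multiset.induction_on with
  | empty => simp [Algebra.algebraMap_eq_smul_one, hc]
  | cons a r ih =>
    rw [Multiset.map_cons, Multiset.prod_cons, mul_left_comm, map_mul, Matrix.det_mul, ih, h1,
      ← Multiset.prod_map_mul]
    simp

theorem trace_pow_eq {L n : Type*} [Field L] [IsAlgClosed L] [Fintype n] [DecidableEq n]
    (A : Matrix n n L) (k : ℕ) :
    (A ^ k).trace = (A.charpoly.roots.map fun a => a ^ k).sum := by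
  have h : (A ^ k).charpoly = ((A.charpoly.roots.map fun a => a ^ k).map fun a => X - C a).prod := by
    refine Polynomial.funext fun t => ?_
    have h1 := det_aeval_eq A (C t - X ^ k)
    have h2 : aeval A (C t - X ^ k) = Matrix.scalar n t - A ^ k := by
      simp [Algebra.algebraMap_eq_smul_one, Matrix.smul_one_eq_diagonal]
    rw [Matrix.eval_charpoly, ← h2, h1, eval_multiset_prod, Multiset.map_map, Multiset.map_map]
    simp
  rw [Matrix.trace_eq_sum_roots_charpoly, h, roots_multiset_prod_X_sub_C]

theorem multiset_eq_of_powerSums {L : Type*} [Field L] [CharZero L] (s t : Multiset L)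
    (h : ∀ k : ℕ, (s.map fun a => a ^ k).sum = (t.map fun a => a ^ k).sum) : s = t := by
  classical
  have hli := linearIndependent_monoidHom (Multiplicative ℕ) L
  have hli' := hli.comp (fun a : L => powersHom L a) (powersHom L).injective
  rw [linearIndependent_iff'] at hli'
  ext a
  by_cases ha : a ∈ (s + t).toFinset
  · have := hli' (s + t).toFinset (fun b => (s.count b : L) - t.count b) (by
      funext k
      have hk := h k.toAdd
      rw [Finset.sum_multiset_map_count, Finset.sum_multiset_map_count] at hk
      rw [Finset.sum_subset (s₂ := (s + t).toFinset) (by intro x; simp; tauto)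
        (by intro x _ hx; simp_all), Finset.sum_subset (s₁ := t.toFinset) (s₂ := (s + t).toFinset) (by intro x; simp; tauto)
        (by intro x _ hx; simp_all)] at hk
      simp only [Finset.sum_apply, Pi.smul_apply, Function.comp, powersHom_apply, smul_eq_mul,
        sub_mul, Finset.sum_sub_distrib, Pi.zero_apply]
      simpa [sub_eq_zero] using hk) a ha
    exact_mod_cast sub_eq_zero.1 this
  · simp at ha
    simp [ha]

theorem map_trace_pow {K L n : Type*} [Field K] [Field L] [IsAlgClosed L] [Fintype n]
    [DecidableEq n] (φ : K →+* L) (M : Matrix n n K) (k : ℕ) :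
    φ ((M ^ k).trace) = ((M.map φ).charpoly.roots.map fun a => a ^ k).sum := by
  rw [← trace_pow_eq, ← Matrix.map_pow, AddMonoidHom.map_trace]

theorem charpoly_mul_eq {K n₁ n₂ n₃ n₄ : Type*} [Field K] [CharZero K]
    [Fintype n₁] [DecidableEq n₁] [Fintype n₂] [DecidableEq n₂]
    [Fintype n₃] [DecidableEq n₃] [Fintype n₄] [DecidableEq n₄]
    (A : Matrix n₁ n₁ K) (B : Matrix n₂ n₂ K) (A' : Matrix n₃ n₃ K) (B' : Matrix n₄ n₄ K)
    (h : ∀ k : ℕ, (A ^ k).trace + (B' ^ k).trace = (A' ^ k).trace + (B ^ k).trace) :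
    A.charpoly * B'.charpoly = A'.charpoly * B.charpoly := by
  let φ : K →+* AlgebraicClosure K := algebraMap K (AlgebraicClosure K)
  have : CharZero (AlgebraicClosure K) := charZero_of_injective_algebraMap φ.injective
  apply Polynomial.map_injective φ φ.injective
  rw [Polynomial.map_mul, Polynomial.map_mul, ← Matrix.charpoly_map, ← Matrix.charpoly_map,
    ← Matrix.charpoly_map, ← Matrix.charpoly_map]
  have hr : (A.map φ).charpoly.roots + (B'.map φ).charpoly.roots
      = (A'.map φ).charpoly.roots + (B.map φ).charpoly.roots := by
    refine multiset_eq_of_powerSums _ _ fun k => ?_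
    simp only [Multiset.map_add, Multiset.sum_add, ← map_trace_pow, ← map_add, h k]
  rw [(IsAlgClosed.splits (A.map φ).charpoly).eq_prod_roots_of_monic (Matrix.charpoly_monic _),
    (IsAlgClosed.splits (B'.map φ).charpoly).eq_prod_roots_of_monic (Matrix.charpoly_monic _),
    (IsAlgClosed.splits (A'.map φ).charpoly).eq_prod_roots_of_monic (Matrix.charpoly_monic _),
    (IsAlgClosed.splits (B.map φ).charpoly).eq_prod_roots_of_monic (Matrix.charpoly_monic _),
    ← Multiset.prod_add, ← Multiset.prod_add, ← Multiset.map_add, ← Multiset.map_add, hr]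

theorem det_one_add_mul_eq {K n₁ n₂ n₃ n₄ : Type*} [Field K] [CharZero K]
    [Fintype n₁] [DecidableEq n₁] [Fintype n₂] [DecidableEq n₂]
    [Fintype n₃] [DecidableEq n₃] [Fintype n₄] [DecidableEq n₄]
    (A : Matrix n₁ n₁ K) (B : Matrix n₂ n₂ K) (A' : Matrix n₃ n₃ K) (B' : Matrix n₄ n₄ K)
    (h : ∀ k : ℕ, (A ^ k).trace + (B' ^ k).trace = (A' ^ k).trace + (B ^ k).trace) :
    (1 + (X : K[X]) • A.map C).det * (1 + (X : K[X]) • B'.map C).det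
      = (1 + (X : K[X]) • A'.map C).det * (1 + (X : K[X]) • B.map C).det := by
  have key := charpoly_mul_eq (-A) (-B) (-A') (-B') (fun k => by
    rw [neg_pow A, neg_pow B, neg_pow A', neg_pow B']
    rcases Nat.even_or_odd k with hk | hk
    · simpa only [hk.neg_one_pow, one_mul] using h k
    · simp only [hk.neg_one_pow, one_mul, neg_mul, Matrix.trace_neg]
      linear_combination -(h k))
  have key' := congrArg Polynomial.reverse key
  rw [reverse_mul_of_domain, reverse_mul_of_domain, Matrix.reverse_charpoly,
    Matrix.reverse_charpoly, Matrix.reverse_charpoly, Matrix.reverse_charpoly] at key'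
  simpa [Matrix.charpolyRev, Matrix.map_neg, sub_neg_eq_add] using key'

theorem trace_exteriorPower_map {K V : Type*} [Field K] [AddCommGroup V] [Module K V]
    {d : ℕ} (b : Module.Basis (Fin d) K V) (f : V →ₗ[K] V) (k : ℕ) :
    LinearMap.trace K (⋀[K]^k V) (exteriorPower.map k f)
      = (1 + (X : K[X]) • (LinearMap.toMatrix b b f).map C).det.coeff k := by
  classical
  rw [Matrix.coeff_det_one_add_X_smul_eq_sum_minors,
    LinearMap.trace_eq_matrix_trace K (b.exteriorPower k), Matrix.trace, Finset.sum_subtype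
      (p := fun s => s ∈ Set.powersetCard (Fin d) k) _ (fun s => by simp [Set.powersetCard])]
  refine Finset.sum_congr rfl fun s _ => ?_
  rw [Matrix.diag_apply, LinearMap.toMatrix_apply, exteriorPower.basis_repr_apply,
    exteriorPower.basis_apply, exteriorPower.map_apply_ιMulti_family, exteriorPower.ιMulti_family,
    exteriorPower.ιMultiDual_apply_ιMulti, ← Matrix.det_transpose,
    ← Matrix.det_submatrix_equiv_self (Finset.orderIsoOfFin s.val s.prop).toEquiv]
  congr 1
  ext i j
  simp [LinearMap.toMatrix_apply, Set.powersetCard.ofFinEmbEquiv_symm_apply]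
  rfl

end LinearAlgebra

/-! ### The character ring and its operations -/

/-- Characters of finite-dimensional representations of `G` over `K`. -/
def charSet (K : Type u) (G : Type v) [Field K] [Group G] : Set (G → K) :=
  {f | ∃ (n : ℕ) (ρ : Representation K G (Fin n → K)), ρ.character = f}

section
variable {K : Type u} {G : Type v} [Field K] [Group G]

theorem character_mem_charSet {V : Type w} [AddCommGroup V] [Module K V] [FiniteDimensional K V]
    (ρ : Representation K G V) : ρ.character ∈ charSet K G := by
  let e : V ≃ₗ[K] (Fin (Module.finrank K V) → K) := (Module.finBasis K V).equivFun
  refine ⟨Module.finrank K V,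
    { toFun := fun g => e.conj (ρ g)
      map_one' := by rw [map_one]; exact e.conj_id
      map_mul' := fun g h => by rw [map_mul]; exact e.conj_comp _ _ }, ?_⟩
  funext g
  exact LinearMap.trace_conj' (ρ g) e

theorem one_mem_charSet : (1 : G → K) ∈ charSet K G := by
  convert character_mem_charSet (Representation.trivial K G K)
  funext g
  simp [Representation.character]

theorem zero_mem_charSet : (0 : G → K) ∈ charSet K G := by
  convert character_mem_charSet (Representation.trivial K G (Fin 0 → K))
  funext g
  simp [Representation.character]

theorem add_mem_charSet {f f' : G → K} (hf : f ∈ charSet K G) (hf' : f' ∈ charSet K G) :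
    f + f' ∈ charSet K G := by
  obtain ⟨n, ρ, rfl⟩ := hf
  obtain ⟨m, σ, rfl⟩ := hf'
  convert character_mem_charSet (ρ.prod σ)
  funext g
  exact (LinearMap.trace_prodMap' (ρ g) (σ g)).symm

theorem mul_mem_charSet {f f' : G → K} (hf : f ∈ charSet K G) (hf' : f' ∈ charSet K G) :
    f * f' ∈ charSet K G := by
  obtain ⟨n, ρ, rfl⟩ := hf
  obtain ⟨m, σ, rfl⟩ := hf'
  rw [← Representation.char_tensor]
  exact character_mem_charSet (ρ.tprod σ)
end

/-- The ring `R_K(G)` of virtual characters of `G` over `K`: the additive group of functions on `G`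
generated by the characters of finite-dimensional representations, with pointwise product. -/
def CharRing (K : Type u) (G : Type v) [Field K] [Group G] : Subring (G → K) where
  __ := AddSubgroup.closure (charSet K G)
  one_mem' := AddSubgroup.subset_closure one_mem_charSet
  mul_mem' {a b} ha hb := by
    change a * b ∈ AddSubgroup.closure (charSet K G)
    refine AddSubgroup.closure_induction₂ (p := fun x y _ _ => x * y ∈ AddSubgroup.closure _)
      ?_ ?_ ?_ ?_ ?_ ?_ ?_ ha hb
    · exact fun x y hx hy => AddSubgroup.subset_closure (mul_mem_charSet hx hy)
    · intro x _; rw [zero_mul]; exact zero_mem _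
    · intro x _; rw [mul_zero]; exact zero_mem _
    · intro x y z _ _ _ h1 h2; rw [add_mul]; exact add_mem h1 h2
    · intro x y z _ _ _ h1 h2; rw [mul_add]; exact add_mem h1 h2
    · intro x y _ _ h1; rw [neg_mul]; exact neg_mem h1
    · intro x y _ _ h1; rw [mul_neg]; exact neg_mem h1

section Lambda

open Polynomial

variable {K : Type u} {G : Type v} [Field K] [Group G]
variable {V : Type*} [AddCommGroup V] [Module K V] [FiniteDimensional K V]
variable {W : Type*} [AddCommGroup W] [Module K W] [FiniteDimensional K W]

/-- The class in `R_K(G)` of a finite-dimensional representation. -/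
noncomputable def cls (ρ : Representation K G V) : CharRing K G :=
  ⟨ρ.character, AddSubgroup.subset_closure (character_mem_charSet ρ)⟩

theorem exists_eq_sub (x : CharRing K G) : ∃ (n : ℕ) (ρ : Representation K G (Fin n → K)) (m : ℕ)
    (σ : Representation K G (Fin m → K)), x = cls ρ - cls σ := by
  have key : ∀ f ∈ AddSubgroup.closure (charSet K G),
      ∃ a ∈ charSet K G, ∃ b ∈ charSet K G, f = a - b := by
    intro f hf
    induction hf using AddSubgroup.closure_induction with
    | mem x hx => exact ⟨x, hx, 0, zero_mem_charSet, by simp⟩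
    | zero => exact ⟨0, zero_mem_charSet, 0, zero_mem_charSet, by simp⟩
    | add x y _ _ hx hy =>
      obtain ⟨a, ha, b, hb, rfl⟩ := hx
      obtain ⟨a', ha', b', hb', rfl⟩ := hy
      exact ⟨_, add_mem_charSet ha ha', _, add_mem_charSet hb hb', by abel⟩
    | neg x _ hx =>
      obtain ⟨a, ha, b, hb, rfl⟩ := hx
      exact ⟨b, hb, a, ha, by abel⟩
  obtain ⟨_, ⟨n, ρ, rfl⟩, _, ⟨m, σ, rfl⟩, h⟩ := key x.1 x.2
  exact ⟨n, ρ, m, σ, Subtype.ext h⟩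

/-- The `n`-th exterior power of a representation. -/
noncomputable def extPow (n : ℕ) (ρ : Representation K G V) : Representation K G (⋀[K]^n V) where
  toFun g := exteriorPower.map n (ρ g)
  map_one' := by rw [map_one]; exact exteriorPower.map_id
  map_mul' g h := by
    rw [map_mul, Module.End.mul_eq_comp, exteriorPower.map_comp, Module.End.mul_eq_comp]

/-- The power series `λ_t(ρ) = ∑ₙ [Λⁿ ρ] tⁿ` with coefficients in `R_K(G)`. -/
noncomputable def repLambdaSeries (ρ : Representation K G V) : PowerSeries (CharRing K G) :=
  PowerSeries.mk fun n => cls (extPow n ρ)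

/-- The power series `λ_t(x)` for a virtual character `x`, given by
`λ_t([V] - [W]) = λ_t(V) λ_t(W)⁻¹`. It does not depend on the choice of `V` and `W`, see
`lambdaSeries_mul`. -/
noncomputable def lambdaSeries (x : CharRing K G) : PowerSeries (CharRing K G) :=
  repLambdaSeries (exists_eq_sub x).choose_spec.choose *
    PowerSeries.invOfUnit
      (repLambdaSeries (exists_eq_sub x).choose_spec.choose_spec.choose_spec.choose) 1

/-- The operation `λⁿ` on `R_K(G)`. -/
noncomputable def lambdaOp (n : ℕ) (x : CharRing K G) : CharRing K G :=
  PowerSeries.coeff n (lambdaSeries x)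

/-- Evaluation of virtual characters at a group element. -/
def evalAt (K : Type u) {G : Type v} [Field K] [Group G] (g : G) : CharRing K G →+* K :=
  (Pi.evalRingHom (fun _ : G => K) g).comp (CharRing K G).subtype

theorem map_evalAt_repLambdaSeries {d : ℕ} (b : Module.Basis (Fin d) K V)
    (ρ : Representation K G V) (g : G) :
    PowerSeries.map (evalAt K g) (repLambdaSeries ρ) =
      (((1 + (X : K[X]) • (LinearMap.toMatrix b b (ρ g)).map C).det : K[X]) : PowerSeries K) := by
  ext n
  rw [PowerSeries.coeff_map, repLambdaSeries, PowerSeries.coeff_mk, Polynomial.coeff_coe,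
    ← trace_exteriorPower_map]
  rfl

theorem powerSeries_ext {p q : PowerSeries (CharRing K G)}
    (h : ∀ g, PowerSeries.map (evalAt K g) p = PowerSeries.map (evalAt K g) q) : p = q := by
  ext n g
  have := congrArg (PowerSeries.coeff n) (h g)
  rwa [PowerSeries.coeff_map, PowerSeries.coeff_map] at this

theorem constantCoeff_repLambdaSeries (ρ : Representation K G V) :
    PowerSeries.constantCoeff (repLambdaSeries ρ) = 1 := by
  ext g
  have h0 := congrArg (PowerSeries.coeff 0)
    (map_evalAt_repLambdaSeries (Module.finBasis K V) ρ g)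
  rw [PowerSeries.coeff_map, Polynomial.coeff_coe,
    Matrix.coeff_det_one_add_X_smul_eq_sum_minors] at h0
  simp only [PowerSeries.coeff_zero_eq_constantCoeff, Finset.powersetCard_zero,
    Finset.sum_singleton, Matrix.det_isEmpty] at h0
  exact h0

theorem trace_toMatrix_pow {d : ℕ} (b : Module.Basis (Fin d) K V) (ρ : Representation K G V)
    (g : G) (k : ℕ) : (LinearMap.toMatrix b b (ρ g) ^ k).trace = (cls ρ).1 (g ^ k) := by
  rw [LinearMap.toMatrix_pow, ← LinearMap.trace_eq_matrix_trace, ← map_pow]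
  rfl

theorem repLambdaSeries_mul_eq [CharZero K] {V' : Type*} [AddCommGroup V'] [Module K V']
    [FiniteDimensional K V'] {W' : Type*} [AddCommGroup W'] [Module K W'] [FiniteDimensional K W']
    (ρ : Representation K G V) (σ : Representation K G W) (ρ' : Representation K G V')
    (σ' : Representation K G W') (h : cls ρ - cls σ = cls ρ' - cls σ') :
    repLambdaSeries ρ * repLambdaSeries σ' = repLambdaSeries ρ' * repLambdaSeries σ := by
  refine powerSeries_ext fun g => ?_
  rw [map_mul, map_mul, map_evalAt_repLambdaSeries (Module.finBasis K V),
    map_evalAt_repLambdaSeries (Module.finBasis K W'),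
    map_evalAt_repLambdaSeries (Module.finBasis K V'),
    map_evalAt_repLambdaSeries (Module.finBasis K W), ← Polynomial.coe_mul, ← Polynomial.coe_mul]
  congr 1
  refine det_one_add_mul_eq _ _ _ _ fun k => ?_
  have hk : (cls ρ).1 (g ^ k) - (cls σ).1 (g ^ k) = (cls ρ').1 (g ^ k) - (cls σ').1 (g ^ k) :=
    congrFun (congrArg Subtype.val h) (g ^ k)
  simp only [trace_toMatrix_pow]
  linear_combination hk

/-- `λ_t([V] - [W]) λ_t(W) = λ_t(V)` for all representations `V`, `W`. -/
theorem lambdaSeries_mul [CharZero K] (x : CharRing K G) (ρ : Representation K G V)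
    (σ : Representation K G W) (h : x = cls ρ - cls σ) :
    lambdaSeries x * repLambdaSeries σ = repLambdaSeries ρ := by
  have h1 := repLambdaSeries_mul_eq _ _ ρ σ
    ((exists_eq_sub x).choose_spec.choose_spec.choose_spec.choose_spec.symm.trans h)
  rw [lambdaSeries, mul_right_comm, h1, mul_assoc, PowerSeries.mul_invOfUnit _ _
    (by rw [constantCoeff_repLambdaSeries]; rfl), mul_one]

theorem lambdaOp_cls [CharZero K] (n : ℕ) (ρ : Representation K G V) :
    lambdaOp n (cls ρ) = cls (extPow n ρ) := by
  let τ : Representation K G (Fin 0 → K) := Representation.trivial K G (Fin 0 → K)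
  have h1 : repLambdaSeries τ = 1 := by
    refine powerSeries_ext fun g => ?_
    rw [map_evalAt_repLambdaSeries (Pi.basisFun K (Fin 0)), Matrix.det_isEmpty, map_one,
      Polynomial.coe_one]
  have h2 : cls τ = 0 := by
    ext g
    simp [τ, cls, Representation.character]
  have h3 := lambdaSeries_mul (cls ρ) ρ τ (by rw [h2, sub_zero])
  rw [h1, mul_one] at h3
  rw [lambdaOp, h3, repLambdaSeries, PowerSeries.coeff_mk]

/-- The operation `γⁿ(x) = λⁿ(x + n - 1)`. -/
noncomputable def gammaOp (n : ℕ) (x : CharRing K G) : CharRing K G := lambdaOp n (x + n - 1)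

end Lambda

/-! ### Restriction and induction -/

open Classical in
/-- The formula for induced characters, along a homomorphism `φ : H → G` of finite groups. -/
noncomputable def indFun {K H G : Type*} [Field K] [Group H] [Group G] (φ : H →* G) (f : H → K) :
    G → K := fun k =>
  (Nat.card H : K)⁻¹ * ∑ᶠ (x : G) (h : H), if φ h = x * k * x⁻¹ then f h else 0

section Induction

open Representation TensorProduct

variable {K H G V : Type*} [Field K] [CharZero K] [Group H] [Group G] [Finite H] [Finite G]
  [AddCommGroup V] [Module K V] [FiniteDimensional K V] (φ : H →* G) (ρ : Representation K H V)

instance finiteDimensional_indV : FiniteDimensional K (IndV φ ρ) := by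
  have : Module.Finite K (MonoidAlgebra K G) := inferInstance
  infer_instance

open Classical in
theorem trace_mapDomain [Fintype G] (f : G → G) :
    LinearMap.trace K (MonoidAlgebra K G) (MonoidAlgebra.mapDomainLinearMap K K f)
      = ∑ x : G, if f x = x then 1 else 0 := by
  rw [LinearMap.trace_eq_matrix_trace K (MonoidAlgebra.basis G K), Matrix.trace]
  refine Finset.sum_congr rfl fun x _ => ?_
  rw [Matrix.diag_apply, LinearMap.toMatrix_apply]
  rw [MonoidAlgebra.basis_apply, MonoidAlgebra.mapDomainLinearMap_single,
    ← MonoidAlgebra.basis_apply, Module.Basis.repr_self, Finsupp.single_apply]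

/-- `indFun` computes the character of an induced representation `K[G] ⊗_{K[H]} V`. -/
theorem character_ind : (ind φ ρ).character = indFun φ ρ.character := by
  classical
  have := Fintype.ofFinite H
  have := Fintype.ofFinite G
  funext k
  have hc : (Nat.card H : K) ≠ 0 := Nat.cast_ne_zero.2 Nat.card_pos.ne'
  let τ : Representation K H (MonoidAlgebra K G ⊗[K] V) := tprod ((leftRegular K G).comp φ) ρ
  let avg : (MonoidAlgebra K G ⊗[K] V) →ₗ[K] (MonoidAlgebra K G ⊗[K] V) :=
    (Nat.card H : K)⁻¹ • ∑ h : H, τ h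
  let s : IndV φ ρ →ₗ[K] (MonoidAlgebra K G ⊗[K] V) := Coinvariants.lift τ avg (fun g => by
    have h0 : ∑ h : H, τ h * τ g = ∑ h : H, τ h :=
      Fintype.sum_equiv (Equiv.mulRight g) _ _ (fun h => by rw [Equiv.coe_mulRight, map_mul])
    change ((Nat.card H : K)⁻¹ • ∑ h : H, τ h) * τ g = _
    rw [smul_mul_assoc, Finset.sum_mul, h0])
  let mk : (MonoidAlgebra K G ⊗[K] V) →ₗ[K] IndV φ ρ := Coinvariants.mk τ
  have h1 : mk ∘ₗ s = LinearMap.id := by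
    refine Coinvariants.hom_ext (LinearMap.ext fun v => ?_)
    change mk (avg v) = mk v
    simp only [avg, LinearMap.smul_apply, LinearMap.sum_apply, map_smul, map_sum]
    have : ∀ h : H, mk (τ h v) = mk v := fun h => Coinvariants.mk_self_apply τ h v
    simp only [this, Finset.sum_const, Finset.card_univ, ← Nat.card_eq_fintype_card]
    rw [← Nat.cast_smul_eq_nsmul K, smul_smul, inv_mul_cancel₀ hc, one_smul]
  have h2 : s ∘ₗ mk = avg := rfl
  let E : (MonoidAlgebra K G ⊗[K] V) →ₗ[K] (MonoidAlgebra K G ⊗[K] V) :=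
    (MonoidAlgebra.mapDomainLinearMap K K fun x => x * k⁻¹).rTensor _
  have h3 : ind φ ρ k ∘ₗ mk = mk ∘ₗ E := rfl
  have h4 : ∀ h : H, E ∘ₗ τ h = TensorProduct.map
      (MonoidAlgebra.mapDomainLinearMap K K fun x => φ h * x * k⁻¹) (ρ h) := by
    intro h
    ext x v
    simp [E, τ]
  calc LinearMap.trace K _ (ind φ ρ k)
      = LinearMap.trace K _ ((ind φ ρ k ∘ₗ mk) ∘ₗ s) := by
        rw [LinearMap.comp_assoc, h1, LinearMap.comp_id]
    _ = LinearMap.trace K _ (E ∘ₗ avg) := by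
        rw [h3, LinearMap.comp_assoc, LinearMap.trace_comp_comm', LinearMap.comp_assoc, h2]
    _ = (Nat.card H : K)⁻¹ * ∑ h : H, LinearMap.trace K _ (E ∘ₗ τ h) := by
        have h0 : E ∘ₗ avg = (Nat.card H : K)⁻¹ • ∑ h : H, E ∘ₗ τ h := by
          change E * ((Nat.card H : K)⁻¹ • ∑ h : H, τ h) = _
          rw [mul_smul_comm, Finset.mul_sum]
          rfl
        rw [h0, map_smul, map_sum, smul_eq_mul]
    _ = indFun φ ρ.character k := by
        rw [indFun, finsum_eq_sum_of_fintype]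
        congr 1
        simp only [finsum_eq_sum_of_fintype]
        rw [Finset.sum_comm]
        refine Finset.sum_congr rfl fun h _ => ?_
        rw [h4, LinearMap.trace_tensorProduct', trace_mapDomain, Finset.sum_mul]
        refine Finset.sum_congr rfl fun x _ => ?_
        rw [ite_mul, one_mul, zero_mul]
        congr 1
        rw [mul_inv_eq_iff_eq_mul, ← eq_mul_inv_iff_mul_eq]
end Induction

theorem indFun_zero {K H G : Type*} [Field K] [Group H] [Group G] (φ : H →* G) :
    indFun φ (0 : H → K) = 0 := by
  funext k
  simp [indFun]

theorem indFun_add {K H G : Type*} [Field K] [Group H] [Group G] [Finite H] [Finite G]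
    (φ : H →* G) (f f' : H → K) : indFun φ (f + f') = indFun φ f + indFun φ f' := by
  have := Fintype.ofFinite H
  have := Fintype.ofFinite G
  funext k
  simp only [indFun, finsum_eq_sum_of_fintype, Pi.add_apply]
  rw [← mul_add, ← Finset.sum_add_distrib]
  congr 1
  refine Finset.sum_congr rfl fun x _ => ?_
  rw [← Finset.sum_add_distrib]
  refine Finset.sum_congr rfl fun h _ => ?_
  split_ifs <;> simp

theorem indFun_neg {K H G : Type*} [Field K] [Group H] [Group G] [Finite H] [Finite G]
    (φ : H →* G) (f : H → K) : indFun φ (-f) = -indFun φ f := by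
  rw [eq_neg_iff_add_eq_zero, ← indFun_add, neg_add_cancel, indFun_zero]

/-- Restriction of virtual characters along a group homomorphism. -/
def pullback (K : Type u) {H : Type v} {G : Type w} [Field K] [Group H] [Group G] (φ : H →* G) :
    CharRing K G →+* CharRing K H :=
  (((RingHom.pi fun h : H => Pi.evalRingHom (fun _ : G => K) (φ h)).comp
    (CharRing K G).subtype)).codRestrict (CharRing K H) (by
      rintro ⟨f, hf⟩
      change f ∘ φ ∈ AddSubgroup.closure (charSet K H)
      change f ∈ AddSubgroup.closure (charSet K G) at hf
      induction hf using AddSubgroup.closure_induction with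
      | mem f hf =>
        obtain ⟨n, ρ, rfl⟩ := hf
        exact AddSubgroup.subset_closure ⟨n, ρ.comp φ, rfl⟩
      | zero => exact zero_mem _
      | add x y _ _ hx hy => exact add_mem hx hy
      | neg x _ hx => exact neg_mem hx)

/-- Induction of virtual characters along a homomorphism of finite groups. On the class of a
representation it is the class of the induced representation, see `ind_cls`. -/
noncomputable def ind (K : Type u) {H : Type v} {G : Type w} [Field K] [CharZero K] [Group H]
    [Group G] [Finite H] [Finite G] (φ : H →* G) : CharRing K H →+ CharRing K G where
  toFun f := ⟨indFun φ f.1, by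
    obtain ⟨f, hf⟩ := f
    change indFun φ f ∈ AddSubgroup.closure (charSet K G)
    change f ∈ AddSubgroup.closure (charSet K H) at hf
    induction hf using AddSubgroup.closure_induction with
    | mem f hf =>
      obtain ⟨n, ρ, rfl⟩ := hf
      rw [← character_ind]
      exact AddSubgroup.subset_closure (character_mem_charSet _)
    | zero => rw [indFun_zero]; exact zero_mem _
    | add x y _ _ hx hy => rw [indFun_add]; exact add_mem hx hy
    | neg x _ hx => rw [indFun_neg]; exact neg_mem hx⟩
  map_zero' := Subtype.ext (indFun_zero φ)
  map_add' f f' := Subtype.ext (indFun_add φ f.1 f'.1)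

theorem ind_cls {K : Type u} {H : Type v} {G : Type w} [Field K] [CharZero K] [Group H]
    [Group G] [Finite H] [Finite G] (φ : H →* G) {V : Type*} [AddCommGroup V] [Module K V]
    [FiniteDimensional K V] (ρ : Representation K H V) :
    ind K φ (cls ρ) = cls (Representation.ind φ ρ) :=
  Subtype.ext (character_ind φ ρ).symm

/-! ### The Grothendieck filtration and the saturated filtration -/

/-- The augmentation ideal: virtual characters of degree zero. -/
def augIdeal (K : Type u) (G : Type v) [Field K] [Group G] : Ideal (CharRing K G) :=
  RingHom.ker (evalAt K (1 : G))

/-- The Grothendieck filtration: `Γⁿ` is generated, as an additive group, by the monomials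
`γ^{n₁}(x₁) ⋯ γ^{n_k}(x_k)` with `x_i` in the augmentation ideal and `n₁ + ⋯ + n_k ≥ n`. -/
def gammaFiltration (K : Type u) (G : Type v) [Field K] [Group G] (n : ℕ) :
    AddSubgroup (CharRing K G) :=
  AddSubgroup.closure {y | ∃ l : List (ℕ × augIdeal K G), n ≤ (l.map fun p => p.1).sum ∧
    y = (l.map fun p => gammaOp p.1 (p.2 : CharRing K G)).prod}

/-- The saturated filtration `Fⁿ(G) = ∑_{H ≤ G} Ind_H^G Γⁿ(H)`. -/
noncomputable def satFiltration (K : Type u) (G : Type v) [Field K] [CharZero K] [Group G]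
    [Finite G] (n : ℕ) : AddSubgroup (CharRing K G) :=
  ⨆ H : Subgroup G, (gammaFiltration K H n).map (ind K H.subtype)

/-- The graded piece `Fⁿ(G) / Fⁿ⁺¹(G)`. -/
abbrev satPiece (K : Type u) (G : Type v) [Field K] [CharZero K] [Group G] [Finite G] (n : ℕ) :=
  satFiltration K G n ⧸ (satFiltration K G (n + 1)).addSubgroupOf (satFiltration K G n)

/-- The additive group `⨁ₙ Fⁿ(G) / Fⁿ⁺¹(G)` of the saturated graded ring. -/
abbrev SatGraded (K : Type u) (G : Type v) [Field K] [CharZero K] [Group G] [Finite G] :=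
  DirectSum ℕ (satPiece K G)

/-- The class in degree `n` of an element of `Fⁿ(G)`. -/
noncomputable def gradedClass (K : Type u) (G : Type v) [Field K] [CharZero K] [Group G]
    [Finite G] (n : ℕ) : satFiltration K G n →+ SatGraded K G :=
  (DirectSum.of (satPiece K G) n).comp (QuotientAddGroup.mk' _)

/-! ### Mackey functors -/

section Mackey

variable {G : Type v} [Group G]

/-- The conjugate subgroup `ᵍH = g H g⁻¹`. -/
abbrev conjSubgroup (g : G) (H : Subgroup G) : Subgroup G := H.map (MulAut.conj g).toMonoidHom

theorem inf_conj_eq (x : G) (J L : Subgroup G) :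
    J ⊓ conjSubgroup x L = conjSubgroup x (conjSubgroup x⁻¹ J ⊓ L) := by
  ext y
  simp only [conjSubgroup, Subgroup.mem_inf, Subgroup.mem_map, MulEquiv.coe_toMonoidHom,
    MulAut.conj_apply]
  constructor
  · rintro ⟨hy, z, hz, rfl⟩
    exact ⟨z, ⟨⟨_, hy, by group⟩, hz⟩, rfl⟩
  · rintro ⟨z, ⟨⟨w, hw, rfl⟩, hz⟩, rfl⟩
    exact ⟨by simpa [mul_assoc] using hw, _, hz, rfl⟩

/-- The homomorphism `ᵍH → H`, `y ↦ g⁻¹ y g`. -/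
def conjHom (g : G) {H H' : Subgroup G} (e : H' = conjSubgroup g H) : H' →* H :=
  ((MulAut.conj g⁻¹).toMonoidHom.comp H'.subtype).codRestrict H (by
    subst e
    rintro ⟨_, z, hz, rfl⟩
    simpa [mul_assoc] using hz)

/-- A Mackey functor for the finite group `G` over the commutative ring `A`, with values `S H` on
the subgroups `H ≤ G`: restrictions `S H → S L` and inductions `S L → S H` for `L ≤ H`, and
conjugations `c_g : S H → S (ᵍH)`, subject to the usual axioms. The target of a conjugation is a
subgroup `H'` with a proof of `H' = ᵍH`, which avoids transport along equalities of subgroups. -/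
structure MackeyFunctor (A : Type*) [CommRing A] (G : Type v) [Group G] [Finite G]
    (S : Subgroup G → Type*) [∀ H, AddCommGroup (S H)] [∀ H, Module A (S H)] where
  res : ∀ {L H : Subgroup G}, L ≤ H → (S H →ₗ[A] S L)
  ind : ∀ {L H : Subgroup G}, L ≤ H → (S L →ₗ[A] S H)
  conj : ∀ (g : G) {H H' : Subgroup G}, H' = conjSubgroup g H → (S H →ₗ[A] S H')
  res_self : ∀ (H : Subgroup G) (x : S H), res (le_refl H) x = x
  ind_self : ∀ (H : Subgroup G) (x : S H), ind (le_refl H) x = x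
  conj_self : ∀ (H : Subgroup G) (h : G) (_ : h ∈ H) (e : H = conjSubgroup h H) (x : S H),
    conj h e x = x
  res_res : ∀ {J L H : Subgroup G} (hJ : J ≤ L) (hL : L ≤ H) (x : S H),
    res hJ (res hL x) = res (hJ.trans hL) x
  ind_ind : ∀ {J L H : Subgroup G} (hJ : J ≤ L) (hL : L ≤ H) (x : S J),
    ind hL (ind hJ x) = ind (hJ.trans hL) x
  conj_conj : ∀ (g h : G) {H H' H'' : Subgroup G} (e' : H' = conjSubgroup h H)
    (e'' : H'' = conjSubgroup g H') (e : H'' = conjSubgroup (g * h) H) (x : S H),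
    conj g e'' (conj h e' x) = conj (g * h) e x
  res_conj : ∀ (g : G) {L H L' H' : Subgroup G} (hL : L ≤ H) (hL' : L' ≤ H')
    (eL : L' = conjSubgroup g L) (eH : H' = conjSubgroup g H) (x : S H),
    res hL' (conj g eH x) = conj g eL (res hL x)
  ind_conj : ∀ (g : G) {L H L' H' : Subgroup G} (hL : L ≤ H) (hL' : L' ≤ H')
    (eL : L' = conjSubgroup g L) (eH : H' = conjSubgroup g H) (x : S L),
    ind hL' (conj g eL x) = conj g eH (ind hL x)
  /-- The double coset formula
  `Res^H_J Ind_L^H = ∑_{x ∈ J\H/L} Ind_{J ∩ ˣL}^J c_x Res^L_{J^x ∩ L}`, for every choice `r` of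
  representatives of the double cosets. -/
  res_ind : ∀ {J L H : Subgroup G} (hJ : J ≤ H) (hL : L ≤ H)
    (r : DoubleCoset.Quotient (J.subgroupOf H : Set H) (L.subgroupOf H : Set H) → H)
    (_ : ∀ q, DoubleCoset.mk (J.subgroupOf H) (L.subgroupOf H) (r q) = q) (y : S L),
    res hJ (ind hL y) = ∑ᶠ q, ind (inf_le_left : J ⊓ conjSubgroup (r q : G) L ≤ J)
      (conj (r q : G) (inf_conj_eq (r q : G) J L)
        (res (inf_le_right : conjSubgroup (r q : G)⁻¹ J ⊓ L ≤ L) y))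

end Mackey

end SaturatedRing

namespace SaturatedRing

universe u v w

/-! ### Functoriality of virtual characters -/

section Functoriality

variable {K : Type u} [Field K]

/-! The filtration statements come from formal properties of restriction and induction. Restriction
along any homomorphism commutes with the λ-operations (`pullback_lambdaOp`) and so preserves Γⁿ.
Induction is transitive (`ind_ind`), and along an isomorphism it is restriction along the inverse
(`ind_equiv`); since an injection is an isomorphism onto its range followed by an inclusion,
induction along it sends Γⁿ into Fⁿ, and by transitivity Fⁿ into Fⁿ.

Restriction preserves Fⁿ by the double coset formula (`pullback_ind`): the restriction of an element
induced from Γⁿ(S) is a sum of elements induced, along injections, from restrictions of that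
element, which still lie in Γⁿ. Frobenius reciprocity Ind(x)·y = Ind(x·Res y) (`ind_mul`) then
reduces multiplicativity of F to that of Γ. Finally F⁰ is the whole ring because a virtual character
is an integer plus an element of degree zero, and γ¹ is the identity.

A filtered additive map induces a map of graded groups, compatibly with composition and finite sums.
Each Mackey axiom therefore descends from an identity between maps of character rings, with
conjugation by g treated as restriction along y ↦ g⁻¹yg. Those identities are verified on the
explicit formula for induced characters or deduced from transitivity. -/

theorem pullback_pullback {A B C : Type*} [Group A] [Group B] [Group C] (φ : A →* B) (ψ : B →* C)
    (x : CharRing K C) : pullback K φ (pullback K ψ x) = pullback K (ψ.comp φ) x := rfl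

theorem charRing_conj {G : Type v} [Group G] (x : CharRing K G) (g h : G) :
    x.1 (g * h * g⁻¹) = x.1 h := by
  obtain ⟨n, ρ, m, σ, rfl⟩ := exists_eq_sub x
  change ρ.character _ - σ.character _ = ρ.character _ - σ.character _
  rw [Representation.char_conj, Representation.char_conj]

theorem exists_int_evalAt_one {G : Type v} [Group G] (x : CharRing K G) :
    ∃ d : ℤ, evalAt K 1 x = d := by
  obtain ⟨n, ρ, m, σ, rfl⟩ := exists_eq_sub x
  refine ⟨n - m, ?_⟩
  change ρ.character _ - σ.character _ = _
  simp

variable [CharZero K]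

/-- `lambdaSeries` depends on a chosen presentation of x as a difference, which restriction need not
respect. Its characterisation λ_t(x)·λ_t(W) = λ_t(V) is respected, since Λⁿ of a restricted
representation is the restriction of Λⁿ, and λ_t(W) is a unit and can be cancelled. -/
theorem pullback_lambdaOp {A B : Type*} [Group A] [Group B] (φ : A →* B) (n : ℕ)
    (x : CharRing K B) : pullback K φ (lambdaOp n x) = lambdaOp n (pullback K φ x) := by
  obtain ⟨k, ρ, m, σ, h⟩ := exists_eq_sub x
  have h1 := congrArg (PowerSeries.map (pullback K φ)) (lambdaSeries_mul x ρ σ h)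
  have h2 := lambdaSeries_mul (pullback K φ x) (ρ.comp φ) (σ.comp φ) (by
    rw [h, map_sub]; rfl)
  have h3 : ∀ {d : ℕ} (τ : Representation K B (Fin d → K)),
      PowerSeries.map (pullback K φ) (repLambdaSeries τ) = repLambdaSeries (τ.comp φ) :=
    fun τ => rfl
  rw [map_mul, h3, h3, ← h2] at h1
  have h4 : IsUnit (repLambdaSeries (σ.comp φ)) := by
    rw [PowerSeries.isUnit_iff_constantCoeff, constantCoeff_repLambdaSeries]
    exact isUnit_one
  have h5 := h4.mul_right_cancel h1
  rw [lambdaOp, lambdaOp, ← h5, PowerSeries.coeff_map]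

theorem pullback_gammaOp {A B : Type*} [Group A] [Group B] (φ : A →* B) (n : ℕ)
    (x : CharRing K B) : pullback K φ (gammaOp n x) = gammaOp n (pullback K φ x) := by
  rw [gammaOp, gammaOp, pullback_lambdaOp, map_sub, map_add, map_natCast, map_one]

/-! ### Transitivity of induction, isomorphisms, and Frobenius reciprocity. -/

omit [CharZero K] in
open Classical in
theorem indFun_eq_sum {A B : Type*} [Group A] [Group B] [Fintype A] [Fintype B] (φ : A →* B)
    (f : A → K) (k : B) : indFun φ f k =
      (Fintype.card A : K)⁻¹ * ∑ x : B, ∑ a : A, if φ a = x * k * x⁻¹ then f a else 0 := by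
  simp only [indFun, finsum_eq_sum_of_fintype, Nat.card_eq_fintype_card]

/-- Transitivity of induction. -/
theorem ind_ind {A B C : Type*} [Group A] [Group B] [Group C] [Finite A] [Finite B] [Finite C]
    (φ : A →* B) (ψ : B →* C) (f : CharRing K A) :
    ind K ψ (ind K φ f) = ind K (ψ.comp φ) f := by
  classical
  have := Fintype.ofFinite A
  have := Fintype.ofFinite B
  have := Fintype.ofFinite C
  have hB : (Fintype.card B : K) ≠ 0 := Nat.cast_ne_zero.2 Fintype.card_ne_zero
  refine Subtype.ext (funext fun k => ?_)
  change indFun ψ (indFun φ f.1) k = indFun (ψ.comp φ) f.1 k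
  rw [indFun_eq_sum, indFun_eq_sum, inv_mul_eq_iff_eq_mul₀ hB, mul_left_comm]
  simp only [indFun_eq_sum, ← mul_ite_zero, ← Finset.mul_sum]
  congr 1
  -- For fixed y and a, the condition φ a = y b y⁻¹ determines b, so the sum over b collapses to one
  -- term.
  have h1 : ∀ x : C, (∑ b : B, if ψ b = x * k * x⁻¹ then
      ∑ y : B, ∑ a : A, (if φ a = y * b * y⁻¹ then f.1 a else 0) else 0)
      = ∑ y : B, ∑ a : A, if ψ (φ a) = (ψ y * x) * k * (ψ y * x)⁻¹ then f.1 a else 0 := by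
    intro x
    have h2 : ∀ b : B, (if ψ b = x * k * x⁻¹ then
        ∑ y : B, ∑ a : A, (if φ a = y * b * y⁻¹ then f.1 a else 0) else 0)
        = ∑ y : B, ∑ a : A, if b = y⁻¹ * φ a * y then
            (if ψ b = x * k * x⁻¹ then f.1 a else 0) else 0 := by
      intro b
      have h3 : ∀ y a, φ a = y * b * y⁻¹ ↔ b = y⁻¹ * φ a * y := fun y a => by
        rw [eq_mul_inv_iff_mul_eq, mul_assoc, ← inv_mul_eq_iff_eq_mul, eq_comm]
      simp only [h3]
      split_ifs
      · rfl
      · simp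
    rw [Finset.sum_congr rfl fun b _ => h2 b, Finset.sum_comm]
    refine Finset.sum_congr rfl fun y _ => ?_
    rw [Finset.sum_comm]
    refine Finset.sum_congr rfl fun a _ => ?_
    rw [Finset.sum_ite_eq' Finset.univ, if_pos (Finset.mem_univ _)]
    congr 1
    rw [map_mul, map_mul, map_inv, mul_assoc, inv_mul_eq_iff_eq_mul, ← eq_mul_inv_iff_mul_eq]
    simp [mul_assoc]
  simp only [h1]
  rw [Finset.sum_comm]
  rw [← nsmul_eq_mul, ← Finset.card_univ]
  refine Finset.sum_eq_card_nsmul fun y _ => ?_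
  -- Substituting ψ(y)x for x removes the dependence on y; the |B| equal terms cancel the factor
  -- 1/|B|.
  exact Fintype.sum_equiv (Equiv.mulLeft (ψ y)) _ _ fun x => rfl

/-- Induction along an isomorphism is restriction along its inverse. -/
theorem ind_equiv {A B : Type*} [Group A] [Group B] [Finite A] [Finite B]
    (e : A ≃* B) (f : CharRing K A) :
    ind K e.toMonoidHom f = pullback K e.symm.toMonoidHom f := by
  classical
  have := Fintype.ofFinite A
  have := Fintype.ofFinite B
  have hA : (Fintype.card A : K) ≠ 0 := Nat.cast_ne_zero.2 Fintype.card_ne_zero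
  refine Subtype.ext (funext fun k => ?_)
  change indFun e.toMonoidHom f.1 k = f.1 (e.symm k)
  rw [indFun_eq_sum, inv_mul_eq_iff_eq_mul₀ hA, Fintype.card_congr e.toEquiv, ← nsmul_eq_mul,
    ← Finset.card_univ]
  -- Every x contributes the same value, because f is a class function.
  refine Finset.sum_eq_card_nsmul fun x _ => ?_
  have h1 : ∀ a : A, e a = x * k * x⁻¹ ↔ a = e.symm (x * k * x⁻¹) := fun a => by
    rw [eq_comm, ← e.symm_apply_eq, eq_comm]
  simp only [MulEquiv.toMonoidHom_eq_coe, MonoidHom.coe_coe, h1, Finset.sum_ite_eq', Finset.mem_univ, if_true]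
  rw [map_mul, map_mul, map_inv, charRing_conj]

/-- Frobenius reciprocity. -/
theorem ind_mul {A B : Type*} [Group A] [Group B] [Finite A] [Finite B] (φ : A →* B)
    (x : CharRing K A) (y : CharRing K B) :
    ind K φ x * y = ind K φ (x * pullback K φ y) := by
  classical
  have := Fintype.ofFinite A
  have := Fintype.ofFinite B
  refine Subtype.ext (funext fun k => ?_)
  change indFun φ x.1 k * y.1 k = indFun φ (fun a => x.1 a * y.1 (φ a)) k
  rw [indFun_eq_sum, indFun_eq_sum, mul_assoc, Finset.sum_mul]
  congr 1
  refine Finset.sum_congr rfl fun g _ => ?_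
  rw [Finset.sum_mul]
  refine Finset.sum_congr rfl fun a _ => ?_
  split_ifs with h
  -- Where the summand survives, φ a is conjugate to k, so y takes the same value at both.
  · rw [h, charRing_conj]
  · rw [zero_mul]

/-! ### The double coset formula. -/

/-- The double coset formula for a pair of homomorphisms `α : J → H` and `β : L → H`, with
`D q` the fibre product of `α` and of the conjugate of `β` by `r q`. -/
theorem pullback_ind {H J L : Type*} [Group H] [Group J] [Group L] [Finite H] [Finite J]
    [Finite L] (α : J →* H) (β : L →* H) (J' L' : Subgroup H) (hJ : α.range = J')
    (hL : β.range = L') (r : DoubleCoset.Quotient (J' : Set H) (L' : Set H) → H)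
    (hr : ∀ q, DoubleCoset.mk J' L' (r q) = q)
    (D : DoubleCoset.Quotient (J' : Set H) (L' : Set H) → Type*) [∀ q, Group (D q)]
    [∀ q, Finite (D q)] (δ : ∀ q, D q →* J) (ε : ∀ q, D q →* L)
    (hD : ∀ q d, α (δ q d) = r q * β (ε q d) * (r q)⁻¹)
    (hD' : ∀ q a b, α a = r q * β b * (r q)⁻¹ → ∃! d, δ q d = a ∧ ε q d = b)
    (y : CharRing K L) :
    pullback K α (ind K β y) = ∑ᶠ q, ind K (δ q) (pullback K (ε q) y) := by
  classical
  have := Fintype.ofFinite H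
  have := Fintype.ofFinite J
  have := Fintype.ofFinite L
  have := fun q => Fintype.ofFinite (D q)
  have : Finite (DoubleCoset.Quotient (J' : Set H) (L' : Set H)) :=
    Finite.of_surjective (DoubleCoset.mk J' L') fun q => ⟨r q, hr q⟩
  have := Fintype.ofFinite (DoubleCoset.Quotient (J' : Set H) (L' : Set H))
  have hcL : (Fintype.card L : K) ≠ 0 := Nat.cast_ne_zero.2 Fintype.card_ne_zero
  have hcD : ∀ q, (Fintype.card (D q) : K) ≠ 0 := fun q => Nat.cast_ne_zero.2 Fintype.card_ne_zero
  refine Subtype.ext (funext fun j => ?_)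
  rw [finsum_eq_sum_of_fintype, AddSubmonoidClass.coe_finsetSum, Finset.sum_apply]
  change indFun β y.1 (α j) = ∑ q, indFun (δ q) (fun d => y.1 (ε q d)) j
  -- F x is the inner sum of the induced character, so the left side is |L|⁻¹ ∑ F(x) over H. The aim
  -- is to split this sum according to the double coset of x⁻¹.
  let F : H → K := fun x => ∑ b : L, if β b = x * α j * x⁻¹ then y.1 b else 0
  have hF : ∀ (b : L) (x : H), F ((β b)⁻¹ * x) = F x := by
    intro b x
    refine Fintype.sum_equiv (MulAut.conj b).toEquiv _ _ fun c => ?_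
    change _ = if β (b * c * b⁻¹) = _ then y.1 (b * c * b⁻¹) else 0
    rw [charRing_conj]
    congr 1
    rw [map_mul, map_mul, map_inv, mul_inv_eq_iff_eq_mul, ← eq_inv_mul_iff_mul_eq]
    simp [mul_assoc]
  -- By the fibre product property, ε matches the d with δ d = a j a⁻¹ with the b that contribute to
  -- F at (r q)⁻¹ α(a).
  have h1 : ∀ q, indFun (δ q) (fun d => y.1 (ε q d)) j
      = (Fintype.card (D q) : K)⁻¹ * ∑ a : J, F ((r q)⁻¹ * α a) := by
    intro q
    rw [indFun_eq_sum]
    congr 1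
    refine Finset.sum_congr rfl fun a _ => ?_
    simp only [F]
    rw [← Finset.sum_filter, ← Finset.sum_filter]
    refine Finset.sum_bij (fun d _ => ε q d) ?_ ?_ ?_ ?_
    · intro d hd
      rw [Finset.mem_filter_univ] at hd ⊢
      have := hD q d
      rw [hd, eq_mul_inv_iff_mul_eq, ← inv_mul_eq_iff_eq_mul] at this
      rw [← this]
      simp [mul_assoc]
    · intro d hd d' hd' h
      rw [Finset.mem_filter_univ] at hd hd'
      exact (hD' q _ _ (hD q d)).unique ⟨rfl, rfl⟩ ⟨hd'.trans hd.symm, h.symm⟩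
    · intro b hb
      rw [Finset.mem_filter_univ] at hb
      obtain ⟨d, ⟨h1, h2⟩, -⟩ := hD' q (a * j * a⁻¹) b (by rw [hb]; simp [mul_assoc])
      exact ⟨d, (Finset.mem_filter_univ _).2 h1, h2⟩
    · exact fun _ _ => rfl
  -- Double counting over J × L: the map p below has the part of H indexed by q as its image, and
  -- each of its nonempty fibres has |D q| elements. Summing F ∘ p over J × L in two ways compares
  -- the sum over a ∈ J with the sum over that part.
  have h2 : ∀ q, ∑ x : H with DoubleCoset.mk J' L' x⁻¹ = q, F x
      = Fintype.card L * ((Fintype.card (D q) : K)⁻¹ * ∑ a : J, F ((r q)⁻¹ * α a)) := by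
    intro q
    let p : J × L → H := fun c => (β c.2)⁻¹ * ((r q)⁻¹ * α c.1)
    have hp : ∀ x, DoubleCoset.mk J' L' x⁻¹ = q ↔ ∃ c, p c = x := by
      intro x
      rw [← hr q, eq_comm, DoubleCoset.eq]
      subst hJ hL
      constructor
      · rintro ⟨_, ⟨a, rfl⟩, _, ⟨b, rfl⟩, h⟩
        refine ⟨(a⁻¹, b), ?_⟩
        rw [← inv_inj, h]
        simp [p, mul_assoc]
      · rintro ⟨c, rfl⟩
        exact ⟨_, ⟨c.1⁻¹, rfl⟩, _, ⟨c.2, rfl⟩, by simp [p, mul_assoc]⟩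
    have hcard : ∀ x, DoubleCoset.mk J' L' x⁻¹ = q →
        (Finset.univ.filter fun c => p c = x).card = Fintype.card (D q) := by
      intro x hx
      obtain ⟨⟨a, b⟩, rfl⟩ := (hp x).1 hx
      rw [← Finset.card_univ]
      symm
      -- D q acts simply transitively on the fibre of p through (a, b), by left translation via δ
      -- and ε.
      refine Finset.card_bij (fun d _ => (δ q d * a, ε q d * b)) ?_ ?_ ?_
      · intro d _
        rw [Finset.mem_filter_univ]
        simp [p, hD, mul_assoc]
      · intro d _ d' _ h
        rw [Prod.mk.injEq, mul_left_inj, mul_left_inj] at h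
        exact (hD' q _ _ (hD q d)).unique ⟨rfl, rfl⟩ ⟨h.1.symm, h.2.symm⟩
      · rintro ⟨a', b'⟩ h
        rw [Finset.mem_filter_univ] at h
        obtain ⟨d, ⟨h1, h2⟩, -⟩ := hD' q (a' * a⁻¹) (b' * b⁻¹) (by
          change (β b')⁻¹ * ((r q)⁻¹ * α a') = (β b)⁻¹ * ((r q)⁻¹ * α a) at h
          rw [inv_mul_eq_iff_eq_mul, inv_mul_eq_iff_eq_mul] at h
          rw [map_mul, h]
          simp [mul_assoc])
        exact ⟨d, Finset.mem_univ _, by simp [h1, h2]⟩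
    have h3 : ∑ c : J × L, F (p c) = Fintype.card L * ∑ a : J, F ((r q)⁻¹ * α a) := by
      simp only [p, hF, Fintype.sum_prod_type, Finset.sum_const, Finset.card_univ, nsmul_eq_mul,
        Finset.mul_sum]
    have h4 : ∑ c : J × L, F (p c)
        = Fintype.card (D q) * ∑ x : H with DoubleCoset.mk J' L' x⁻¹ = q, F x := by
      rw [← Finset.sum_fiberwise_of_maps_to (s := Finset.univ)
        (t := Finset.univ.filter fun x => DoubleCoset.mk J' L' x⁻¹ = q) (g := p)
        (fun c _ => (Finset.mem_filter_univ _).2 ((hp _).2 ⟨c, rfl⟩)), Finset.mul_sum]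
      refine Finset.sum_congr rfl fun x hx => ?_
      rw [← hcard x ((Finset.mem_filter_univ (p := fun x => DoubleCoset.mk J' L' x⁻¹ = q) x).1 hx), ← nsmul_eq_mul]
      refine Finset.sum_eq_card_nsmul fun c hc => ?_
      rw [(Finset.mem_filter_univ _).1 hc]
    rw [mul_left_comm, ← h3, h4, inv_mul_cancel_left₀ (hcD q)]
  rw [indFun_eq_sum, inv_mul_eq_iff_eq_mul₀ hcL, Finset.mul_sum]
  simp only [h1, ← h2]
  exact (Finset.sum_fiberwise Finset.univ (fun x : H => DoubleCoset.mk J' L' x⁻¹) F).symm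

end Functoriality

/-! ### The saturated filtration -/

section Filtration

variable {K : Type u} [Field K] [CharZero K]

/-! ### The Grothendieck filtration: products, restriction, and degree zero. -/

omit [CharZero K] in
theorem gammaFiltration_anti {G : Type v} [Group G] {m n : ℕ} (h : m ≤ n) :
    gammaFiltration K G n ≤ gammaFiltration K G m :=
  AddSubgroup.closure_mono fun _ ⟨l, hl, hy⟩ => ⟨l, h.trans hl, hy⟩

omit [CharZero K] in
theorem mul_mem_gammaFiltration {G : Type v} [Group G] {m n : ℕ} {x y : CharRing K G}
    (hx : x ∈ gammaFiltration K G m) (hy : y ∈ gammaFiltration K G n) :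
    x * y ∈ gammaFiltration K G (m + n) := by
  induction hx using AddSubgroup.closure_induction with
  | mem x hx =>
    induction hy using AddSubgroup.closure_induction with
    | mem y hy =>
      obtain ⟨l, hl, rfl⟩ := hx
      obtain ⟨l', hl', rfl⟩ := hy
      refine AddSubgroup.subset_closure ⟨l ++ l', ?_, ?_⟩
      · rw [List.map_append, List.sum_append]
        exact add_le_add hl hl'
      · rw [List.map_append, List.prod_append]
    | zero => rw [mul_zero]; exact zero_mem _
    | add y z _ _ h1 h2 => rw [mul_add]; exact add_mem h1 h2
    | neg y _ h1 => rw [mul_neg]; exact neg_mem h1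
  | zero => rw [zero_mul]; exact zero_mem _
  | add y z _ _ h1 h2 => rw [add_mul]; exact add_mem h1 h2
  | neg y _ h1 => rw [neg_mul]; exact neg_mem h1

omit [CharZero K] in
theorem pullback_mem_augIdeal {A B : Type*} [Group A] [Group B] (φ : A →* B)
    {x : CharRing K B} (hx : x ∈ augIdeal K B) : pullback K φ x ∈ augIdeal K A := by
  change x.1 (φ 1) = 0
  rw [map_one]
  exact hx

theorem pullback_mem_gammaFiltration {A B : Type*} [Group A] [Group B] (φ : A →* B) {n : ℕ}
    {x : CharRing K B} (hx : x ∈ gammaFiltration K B n) :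
    pullback K φ x ∈ gammaFiltration K A n := by
  induction hx using AddSubgroup.closure_induction with
  | mem x hx =>
    obtain ⟨l, hl, rfl⟩ := hx
    refine AddSubgroup.subset_closure
      ⟨l.map fun p => (p.1, ⟨pullback K φ p.2, pullback_mem_augIdeal φ p.2.2⟩), ?_, ?_⟩
    · rw [List.map_map]
      exact hl
    · rw [map_list_prod, List.map_map, List.map_map]
      exact congrArg List.prod (List.map_congr_left fun p _ => pullback_gammaOp φ p.1 _)
  | zero => rw [map_zero]; exact zero_mem _
  | add x y _ _ hx hy => rw [map_add]; exact add_mem hx hy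
  | neg x _ hx => rw [map_neg]; exact neg_mem hx

omit [CharZero K] in
theorem cls_extPow_one {G : Type v} [Group G] {V : Type*} [AddCommGroup V] [Module K V]
    -- The trace on Λ¹ is the linear coefficient of det(1 + Xf), which is the trace of f.
    [FiniteDimensional K V] (ρ : Representation K G V) : cls (extPow 1 ρ) = cls ρ := by
  refine Subtype.ext (funext fun g => ?_)
  let b := Module.finBasis K V
  change LinearMap.trace K _ (exteriorPower.map 1 (ρ g)) = LinearMap.trace K V (ρ g)
  rw [trace_exteriorPower_map b, Matrix.coeff_det_one_add_X_smul_one,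
    LinearMap.trace_eq_matrix_trace K b]

/-- The shift n - 1 vanishes for n = 1, and comparing linear coefficients in λ_t(x)·λ_t(W) = λ_t(V)
gives λ¹(x) + W = V. -/
theorem gammaOp_one {G : Type v} [Group G] (x : CharRing K G) : gammaOp 1 x = x := by
  obtain ⟨n, ρ, m, σ, h⟩ := exists_eq_sub x
  have h1 := lambdaSeries_mul x ρ σ h
  have h0 := congrArg PowerSeries.constantCoeff h1
  rw [map_mul, constantCoeff_repLambdaSeries, constantCoeff_repLambdaSeries, mul_one] at h0
  have h2 := congrArg (PowerSeries.coeff 1) h1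
  rw [PowerSeries.coeff_one_mul, h0, constantCoeff_repLambdaSeries] at h2
  simp only [repLambdaSeries, PowerSeries.coeff_mk, cls_extPow_one, mul_one] at h2
  rw [gammaOp, Nat.cast_one, add_sub_cancel_right, lambdaOp, h]
  rw [h] at h2
  exact eq_sub_of_add_eq h2

theorem gammaFiltration_zero {G : Type v} [Group G] : gammaFiltration K G 0 = ⊤ := by
  rw [eq_top_iff]
  intro x _
  obtain ⟨d, hd⟩ := exists_int_evalAt_one x
  -- The empty monomial is 1; together with the monomials γ¹(x - d) it accounts for every x of
  -- degree d.
  have h1 : (1 : CharRing K G) ∈ gammaFiltration K G 0 :=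
    AddSubgroup.subset_closure ⟨[], le_rfl, rfl⟩
  have h2 : x - d ∈ augIdeal K G := by
    rw [augIdeal, RingHom.mem_ker, map_sub, hd, map_intCast, sub_self]
  have h3 : x - d ∈ gammaFiltration K G 0 :=
    AddSubgroup.subset_closure ⟨[(1, ⟨_, h2⟩)], Nat.zero_le _, by simp [gammaOp_one]⟩
  have h4 := add_mem h3 (zsmul_mem h1 d)
  rwa [zsmul_one, sub_add_cancel] at h4

/-! ### Stability of the saturated filtration under induction, restriction and products. -/

theorem satFiltration_induction {G : Type v} [Group G] [Finite G] {n : ℕ}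
    {p : ∀ x : CharRing K G, x ∈ satFiltration K G n → Prop}
    (mem : ∀ (S : Subgroup G) (x) (hx : x ∈ gammaFiltration K S n),
      p (ind K S.subtype x) (AddSubgroup.mem_iSup_of_mem S ⟨x, hx, rfl⟩))
    (zero : p 0 (zero_mem _))
    (add : ∀ x y hx hy, p x hx → p y hy → p (x + y) (add_mem hx hy)) {x : CharRing K G}
    (hx : x ∈ satFiltration K G n) : p x hx := by
  refine AddSubgroup.iSup_induction' _ (C := p) ?_ zero add hx
  rintro S _ ⟨x, hx, rfl⟩
  exact mem S x hx

/-- Since φ is an isomorphism onto its range followed by an inclusion, only the isomorphism needs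
care: inducing along it is restricting along its inverse, which preserves Γⁿ. -/
theorem ind_mem_satFiltration_of_mem_gammaFiltration {A B : Type*} [Group A] [Group B] [Finite A]
    [Finite B] {φ : A →* B} (hφ : Function.Injective φ) {n : ℕ} {x : CharRing K A}
    (hx : x ∈ gammaFiltration K A n) : ind K φ x ∈ satFiltration K B n := by
  let e : A ≃* φ.range := MonoidHom.ofInjective hφ
  have h1 : φ = φ.range.subtype.comp e.toMonoidHom := rfl
  rw [h1, ← ind_ind, ind_equiv]
  exact AddSubgroup.mem_iSup_of_mem φ.range ⟨_, pullback_mem_gammaFiltration _ hx, rfl⟩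

theorem gammaFiltration_le_satFiltration {G : Type v} [Group G] [Finite G] (n : ℕ) :
    gammaFiltration K G n ≤ satFiltration K G n := by
  intro x hx
  have h := ind_mem_satFiltration_of_mem_gammaFiltration (MulEquiv.refl G).injective
    (φ := (MulEquiv.refl G).toMonoidHom) hx
  rwa [ind_equiv] at h

theorem satFiltration_zero {G : Type v} [Group G] [Finite G] : satFiltration K G 0 = ⊤ := by
  rw [eq_top_iff, ← gammaFiltration_zero]
  exact gammaFiltration_le_satFiltration 0

theorem satFiltration_anti {G : Type v} [Group G] [Finite G] {m n : ℕ} (h : m ≤ n) :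
    satFiltration K G n ≤ satFiltration K G m :=
  iSup_mono fun _ => AddSubgroup.map_mono (gammaFiltration_anti h)

theorem ind_mem_satFiltration {A B : Type*} [Group A] [Group B] [Finite A]
    [Finite B] {φ : A →* B} (hφ : Function.Injective φ) {n : ℕ} {x : CharRing K A}
    (hx : x ∈ satFiltration K A n) : ind K φ x ∈ satFiltration K B n := by
  induction hx using satFiltration_induction with
  | mem S x hx =>
    rw [ind_ind]
    exact ind_mem_satFiltration_of_mem_gammaFiltration (φ := φ.comp S.subtype)
      (hφ.comp S.subtype_injective) hx
  | zero => rw [map_zero]; exact zero_mem _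
  | add x y _ _ hx hy => rw [map_add]; exact add_mem hx hy

/-- The fibre product of `α : J → H` and of the conjugate by `r` of `β : L → H`. -/
def conjFibre {H J L : Type*} [Group H] [Group J] [Group L] (α : J →* H) (β : L →* H) (r : H) :
    Subgroup (J × L) :=
  (α.comp (MonoidHom.fst J L)).eqLocus ((MulAut.conj r).toMonoidHom.comp
    (β.comp (MonoidHom.snd J L)))

/-- The double coset formula, with the fibre products as constructed in `conjFibre`. -/
theorem exists_pullback_ind {H J L : Type v} [Group H] [Group J] [Group L] [Finite H] [Finite J]
    [Finite L] (α : J →* H) {β : L →* H} (hβ : Function.Injective β) :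
    ∃ (Q : Type v) (D : Q → Subgroup (J × L)) (δ : ∀ q, D q →* J) (ε : ∀ q, D q →* L),
      (∀ q, Function.Injective (δ q)) ∧ ∀ y : CharRing K L,
        pullback K α (ind K β y) = ∑ᶠ q, ind K (δ q) (pullback K (ε q) y) := by
  refine ⟨DoubleCoset.Quotient (α.range : Set H) (β.range : Set H),
    fun q => conjFibre α β q.out, fun q => (MonoidHom.fst J L).comp (Subgroup.subtype _),
    fun q => (MonoidHom.snd J L).comp (Subgroup.subtype _), ?_, fun y => ?_⟩
  · rintro q ⟨⟨a, b⟩, h⟩ ⟨⟨a', b'⟩, h'⟩ e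
    have e : a = a' := e
    subst e
    have h : α a = q.out * β b * q.out⁻¹ := h
    have h' : α a = q.out * β b' * q.out⁻¹ := h'
    -- The first coordinate determines β of the second, so injectivity of β makes the projection to
    -- J injective. No injectivity of α is needed.
    rw [h, mul_left_inj, mul_right_inj] at h'
    rw [Subtype.mk.injEq, Prod.mk.injEq]
    exact ⟨rfl, hβ h'⟩
  · refine pullback_ind α β _ _ rfl rfl Quotient.out (DoubleCoset.out_eq' _ _) _ _ _
      (fun q d => d.2) (fun q a b h => ⟨⟨(a, b), h⟩, ⟨rfl, rfl⟩, ?_⟩) y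
    rintro d ⟨rfl, rfl⟩
    rfl

theorem finsum_mem_addSubgroup {M ι : Type*} [AddCommGroup M] (S : AddSubgroup M) (f : ι → M)
    (h : ∀ i, f i ∈ S) : ∑ᶠ i, f i ∈ S :=
  finsum_induction (· ∈ S) (zero_mem S) (fun _ _ => add_mem) h

theorem pullback_mem_satFiltration {A B : Type v} [Group A] [Group B] [Finite A]
    [Finite B] (φ : A →* B) {n : ℕ} {x : CharRing K B}
    (hx : x ∈ satFiltration K B n) : pullback K φ x ∈ satFiltration K A n := by
  induction hx using satFiltration_induction with
  | mem S x hx =>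
    obtain ⟨Q, D, δ, ε, hδ, h⟩ := exists_pullback_ind (K := K) φ S.subtype_injective
    rw [h]
    exact finsum_mem_addSubgroup _ _ fun q => ind_mem_satFiltration_of_mem_gammaFiltration (hδ q)
      (pullback_mem_gammaFiltration _ hx)
  | zero => rw [map_zero]; exact zero_mem _
  | add x y _ _ hx hy => rw [map_add]; exact add_mem hx hy

/-- The case of one factor in Γᵐ: after Frobenius reciprocity the product is formed inside Γ of a
subgroup. `mul_mem_satFiltration` reduces to this case by a second use of reciprocity, which needs
that restriction preserves Fⁿ. -/
theorem gamma_mul_mem_satFiltration {G : Type v} [Group G] [Finite G] {m n : ℕ}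
    {x y : CharRing K G} (hx : x ∈ gammaFiltration K G m) (hy : y ∈ satFiltration K G n) :
    x * y ∈ satFiltration K G (m + n) := by
  induction hy using satFiltration_induction with
  | mem S y hy =>
    rw [mul_comm, ind_mul, mul_comm]
    exact ind_mem_satFiltration_of_mem_gammaFiltration S.subtype_injective
      (mul_mem_gammaFiltration (pullback_mem_gammaFiltration _ hx) hy)
  | zero => rw [mul_zero]; exact zero_mem _
  | add y z _ _ hy hz => rw [mul_add]; exact add_mem hy hz

theorem mul_mem_satFiltration {G : Type v} [Group G] [Finite G] {m n : ℕ}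
    {x y : CharRing K G} (hx : x ∈ satFiltration K G m) (hy : y ∈ satFiltration K G n) :
    x * y ∈ satFiltration K G (m + n) := by
  induction hx using satFiltration_induction with
  | mem S x hx =>
    rw [ind_mul]
    exact ind_mem_satFiltration S.subtype_injective
      (gamma_mul_mem_satFiltration hx (pullback_mem_satFiltration _ hy))
  | zero => rw [zero_mul]; exact zero_mem _
  | add x z _ _ hx hz => rw [add_mul]; exact add_mem hx hz

end Filtration

/-! ### The saturated graded ring -/

section Graded

variable {K : Type u} [Field K] [CharZero K]

/-- Homogeneous classes generate additively, so identities between additive maps need only be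
checked on representatives in Fⁿ. -/
theorem satGraded_induction {G : Type v} [Group G] [Finite G] {p : SatGraded K G → Prop}
    (zero : p 0) (of : ∀ n x, p (gradedClass K G n x)) (add : ∀ x y, p x → p y → p (x + y))
    (x : SatGraded K G) : p x := by
  induction x using DirectSum.induction_on with
  | zero => exact zero
  | of n x =>
    obtain ⟨x, rfl⟩ := QuotientAddGroup.mk'_surjective _ x
    exact of n x
  | add x y hx hy => exact add x y hx hy

/-- The homomorphism of graded groups induced by a filtered homomorphism. -/
noncomputable def gradedMap {A : Type v} {B : Type w} [Group A] [Group B] [Finite A] [Finite B]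
    (f : CharRing K A →+ CharRing K B)
    (hf : ∀ n, ∀ x ∈ satFiltration K A n, f x ∈ satFiltration K B n) :
    SatGraded K A →+ SatGraded K B :=
  DirectSum.map fun n => QuotientAddGroup.map _ _
    ((f.comp (satFiltration K A n).subtype).codRestrict (satFiltration K B n)
      fun x => hf n x.1 x.2)
    fun x hx => hf (n + 1) x.1 hx

theorem gradedMap_gradedClass {A : Type v} {B : Type w} [Group A] [Group B] [Finite A] [Finite B]
    (f : CharRing K A →+ CharRing K B)
    (hf : ∀ n, ∀ x ∈ satFiltration K A n, f x ∈ satFiltration K B n) (n : ℕ)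
    (x : satFiltration K A n) :
    gradedMap f hf (gradedClass K A n x) = gradedClass K B n ⟨f x.1, hf n x.1 x.2⟩ :=
  DirectSum.map_of _ _ _

theorem gradedMap_gradedMap {A B C : Type*} [Group A] [Group B] [Group C] [Finite A] [Finite B]
    [Finite C] (f : CharRing K A →+ CharRing K B)
    (hf : ∀ n, ∀ x ∈ satFiltration K A n, f x ∈ satFiltration K B n)
    (g : CharRing K B →+ CharRing K C)
    (hg : ∀ n, ∀ x ∈ satFiltration K B n, g x ∈ satFiltration K C n) (x : SatGraded K A) :
    gradedMap g hg (gradedMap f hf x) =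
      gradedMap (g.comp f) (fun n x hx => hg n _ (hf n x hx)) x := by
  induction x using satGraded_induction with
  | zero => simp only [map_zero]
  | of n x => simp only [gradedMap_gradedClass]; rfl
  | add x y hx hy => simp only [map_add, hx, hy]

theorem gradedMap_congr {A B : Type*} [Group A] [Group B] [Finite A] [Finite B]
    {f g : CharRing K A →+ CharRing K B}
    (hf : ∀ n, ∀ x ∈ satFiltration K A n, f x ∈ satFiltration K B n)
    (hg : ∀ n, ∀ x ∈ satFiltration K A n, g x ∈ satFiltration K B n) (h : ∀ x, f x = g x)
    (x : SatGraded K A) : gradedMap f hf x = gradedMap g hg x := by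
  obtain rfl : f = g := AddMonoidHom.ext h
  rfl

theorem gradedMap_eq_self {A : Type*} [Group A] [Finite A]
    {f : CharRing K A →+ CharRing K A}
    (hf : ∀ n, ∀ x ∈ satFiltration K A n, f x ∈ satFiltration K A n) (h : ∀ x, f x = x)
    (x : SatGraded K A) : gradedMap f hf x = x := by
  induction x using satGraded_induction with
  | zero => rw [map_zero]
  | of n x => simp only [gradedMap_gradedClass, h]
  | add x y hx hy => rw [map_add, hx, hy]

theorem gradedMap_eq_sum {A B ι : Type*} [Group A] [Group B] [Finite A] [Finite B] [Fintype ι]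
    {f : CharRing K A →+ CharRing K B} {g : ι → CharRing K A →+ CharRing K B}
    (hf : ∀ n, ∀ x ∈ satFiltration K A n, f x ∈ satFiltration K B n)
    (hg : ∀ i, ∀ n, ∀ x ∈ satFiltration K A n, g i x ∈ satFiltration K B n)
    (h : ∀ x, f x = ∑ i, g i x) (x : SatGraded K A) :
    gradedMap f hf x = ∑ i, gradedMap (g i) (hg i) x := by
  induction x using satGraded_induction with
  | zero => simp only [map_zero, Finset.sum_const_zero]
  | of n x =>
    simp only [gradedMap_gradedClass, ← map_sum]
    congr 1
    refine Subtype.ext ?_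
    rw [AddSubgroup.val_finsetSum]
    exact h x.1
  | add x y hx hy => simp only [map_add, hx, hy, Finset.sum_add_distrib]

/-! ### Multiplication on the graded group. -/

/-- The biadditive map of quotients induced by a biadditive map. -/
def quotientMap₂ {A B C : Type*} [AddCommGroup A] [AddCommGroup B] [AddCommGroup C]
    (N : AddSubgroup A) (P : AddSubgroup B) (Q : AddSubgroup C) (f : A →+ B →+ C)
    (hN : ∀ a ∈ N, ∀ b, f a b ∈ Q) (hP : ∀ a, ∀ b ∈ P, f a b ∈ Q) : A ⧸ N →+ B ⧸ P →+ C ⧸ Q :=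
  QuotientAddGroup.lift N
    (AddMonoidHom.mk' (fun a => QuotientAddGroup.map P Q (f a) (hP a)) fun a a' => by
      refine QuotientAddGroup.addMonoidHom_ext _ (AddMonoidHom.ext fun b => ?_)
      change ((f (a + a') b : C) : C ⧸ Q) = (f a b : C) + (f a' b : C)
      rw [map_add, AddMonoidHom.add_apply, QuotientAddGroup.mk_add])
    fun a ha => by
      refine QuotientAddGroup.addMonoidHom_ext _ (AddMonoidHom.ext fun b => ?_)
      exact (QuotientAddGroup.eq_zero_iff _).2 (hN a ha b)

/-- Multiplication `Fᵐ × Fⁿ → Fᵐ⁺ⁿ`. -/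
noncomputable def satMul (K : Type u) (G : Type v) [Field K] [CharZero K] [Group G] [Finite G]
    (m n : ℕ) : satFiltration K G m →+ satFiltration K G n →+ satFiltration K G (m + n) :=
  AddMonoidHom.mk' (fun x => AddMonoidHom.mk'
      (fun y => ⟨x.1 * y.1, mul_mem_satFiltration x.2 y.2⟩)
      fun y y' => Subtype.ext (mul_add x.1 y.1 y'.1))
    fun x x' => AddMonoidHom.ext fun y => Subtype.ext (add_mul x.1 x'.1 y.1)

/-- Multiplication of graded pieces. -/
noncomputable def pieceMul (K : Type u) (G : Type v) [Field K] [CharZero K] [Group G] [Finite G]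
    (m n : ℕ) : satPiece K G m →+ satPiece K G n →+ satPiece K G (m + n) :=
  quotientMap₂ _ _ _ (satMul K G m n)
    (fun x hx y => by
      have h : x.1 * y.1 ∈ satFiltration K G (m + 1 + n) := mul_mem_satFiltration hx y.2
      -- Membership in degree m + 1 + n must be rewritten as degree m + n + 1; in the other variable
      -- m + (n + 1) already has this form by definition.
      rwa [add_right_comm] at h)
    fun x y hy => mul_mem_satFiltration x.2 (n := n + 1) hy

/-- Multiplication in the saturated graded ring. -/
noncomputable def gradedMul (K : Type u) (G : Type v) [Field K] [CharZero K] [Group G] [Finite G] :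
    SatGraded K G →+ SatGraded K G →+ SatGraded K G :=
  DirectSum.toAddMonoid fun m => AddMonoidHom.flip <| DirectSum.toAddMonoid fun n =>
    AddMonoidHom.flip <| (AddMonoidHom.compHom (DirectSum.of (satPiece K G) (m + n))).comp
      (pieceMul K G m n)

theorem gradedMul_gradedClass {G : Type v} [Group G] [Finite G] (m n : ℕ)
    (x : satFiltration K G m) (y : satFiltration K G n) :
    gradedMul K G (gradedClass K G m x) (gradedClass K G n y) =
      gradedClass K G (m + n) ⟨x.1 * y.1, mul_mem_satFiltration x.2 y.2⟩ := by
  change gradedMul K G (DirectSum.of (satPiece K G) m x) (DirectSum.of (satPiece K G) n y) = _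
  rw [gradedMul, DirectSum.toAddMonoid_of, AddMonoidHom.flip_apply, DirectSum.toAddMonoid_of]
  rfl

/-! ### The Mackey functor -/

/-- The map of saturated graded rings induced by restriction along a homomorphism. -/
noncomputable def gradedPullback (K : Type u) [Field K] [CharZero K] {A B : Type v} [Group A]
    [Group B] [Finite A] [Finite B] (φ : A →* B) : SatGraded K B →+ SatGraded K A :=
  gradedMap (pullback K φ).toAddMonoidHom fun _ _ hx => pullback_mem_satFiltration φ hx

/-- The map of saturated graded rings induced by induction along an injective homomorphism. -/
noncomputable def gradedInd (K : Type u) [Field K] [CharZero K] {A B : Type v} [Group A]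
    [Group B] [Finite A] [Finite B] (φ : A →* B) (hφ : Function.Injective φ) :
    SatGraded K A →+ SatGraded K B :=
  gradedMap (ind K φ) fun _ _ hx => ind_mem_satFiltration hφ hx

theorem gradedPullback_id {A : Type v} [Group A] [Finite A] (x : SatGraded K A) :
    gradedPullback K (MonoidHom.id A) x = x :=
  gradedMap_eq_self _ (fun _ => rfl) x

theorem gradedInd_id {A : Type v} [Group A] [Finite A] (x : SatGraded K A) :
    gradedInd K (MonoidHom.id A) Function.injective_id x = x :=
  gradedMap_eq_self _ (ind_equiv (MulEquiv.refl A)) x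

theorem gradedPullback_gradedPullback {A B C : Type v} [Group A] [Group B] [Group C] [Finite A]
    [Finite B] [Finite C] (φ : A →* B) (ψ : B →* C) (x : SatGraded K C) :
    gradedPullback K φ (gradedPullback K ψ x) = gradedPullback K (ψ.comp φ) x :=
  gradedMap_gradedMap _ _ _ _ x

theorem gradedInd_gradedInd {A B C : Type v} [Group A] [Group B] [Group C] [Finite A]
    [Finite B] [Finite C] {φ : A →* B} (hφ : Function.Injective φ) {ψ : B →* C}
    (hψ : Function.Injective ψ) (x : SatGraded K A) :
    gradedInd K ψ hψ (gradedInd K φ hφ x) = gradedInd K (ψ.comp φ) (hψ.comp hφ) x :=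
  (gradedMap_gradedMap _ _ _ _ x).trans (gradedMap_congr _ _ (ind_ind φ ψ) x)

theorem gradedPullback_gradedInd {A B C ι : Type v} [Group A] [Group B] [Group C] [Finite A]
    [Finite B] [Finite C] [Finite ι] (D : ι → Type v) [∀ i, Group (D i)] [∀ i, Finite (D i)]
    (φ : A →* C) {ψ : B →* C} (hψ : Function.Injective ψ) {δ : ∀ i, D i →* A}
    (hδ : ∀ i, Function.Injective (δ i)) (ε : ∀ i, D i →* B)
    (h : ∀ x, pullback K φ (ind K ψ x) = ∑ᶠ i, ind K (δ i) (pullback K (ε i) x))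
    (x : SatGraded K B) :
    gradedPullback K φ (gradedInd K ψ hψ x) =
      ∑ᶠ i, gradedInd K (δ i) (hδ i) (gradedPullback K (ε i) x) := by
  have := Fintype.ofFinite ι
  -- Finiteness of the index type turns both `finsum`s into genuine sums, through which the graded
  -- map can be distributed.
  simp only [finsum_eq_sum_of_fintype] at h ⊢
  simp only [gradedPullback, gradedInd, gradedMap_gradedMap]
  exact gradedMap_eq_sum _ _ h x

/-! ### Conjugation of subgroups and the Mackey axioms. -/

variable {G : Type v} [Group G]

theorem conjHom_bijective (g : G) {H H' : Subgroup G} (e : H' = conjSubgroup g H) :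
    Function.Bijective (conjHom g e) := by
  refine ⟨fun x y h => ?_, fun x => ?_⟩
  · have h : g⁻¹ * x.1 * g⁻¹⁻¹ = g⁻¹ * y.1 * g⁻¹⁻¹ := congrArg Subtype.val h
    rw [mul_left_inj, mul_right_inj] at h
    exact Subtype.ext h
  · subst e
    refine ⟨⟨g * x.1 * g⁻¹, x.1, x.2, rfl⟩, Subtype.ext ?_⟩
    change g⁻¹ * (g * x.1 * g⁻¹) * g⁻¹⁻¹ = x.1
    group

theorem coe_conjHom (g : G) {H H' : Subgroup G} (e : H' = conjSubgroup g H) (y : H') :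
    (conjHom g e y : G) = g⁻¹ * y * g := by
  change g⁻¹ * y.1 * g⁻¹⁻¹ = _
  rw [inv_inv]

omit [CharZero K] in
theorem pullback_conjHom_conjHom (g h : G) {H H' H'' : Subgroup G} (e' : H' = conjSubgroup h H)
    (e'' : H'' = conjSubgroup g H') (e : H'' = conjSubgroup (g * h) H) (x : CharRing K H) :
    pullback K (conjHom g e'') (pullback K (conjHom h e') x) = pullback K (conjHom (g * h) e) x := by
  rw [pullback_pullback]
  refine congrArg (fun φ : H'' →* H => pullback K φ x) (MonoidHom.ext fun z => Subtype.ext ?_)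
  rw [MonoidHom.comp_apply, coe_conjHom, coe_conjHom, coe_conjHom]
  group

variable [Finite G]

/-- Conjugation, being restriction along an isomorphism, is also induction along the inverse.
Transitivity turns both sides into induction along one homomorphism L → H', namely z ↦ g z g⁻¹. -/
theorem ind_pullback_conjHom (g : G) {L H L' H' : Subgroup G} (hL : L ≤ H) (hL' : L' ≤ H')
    (eL : L' = conjSubgroup g L) (eH : H' = conjSubgroup g H) (x : CharRing K L) :
    ind K (Subgroup.inclusion hL') (pullback K (conjHom g eL) x) =
      pullback K (conjHom g eH) (ind K (Subgroup.inclusion hL) x) := by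
  let a : L' ≃* L := MulEquiv.ofBijective (conjHom g eL) (conjHom_bijective g eL)
  let b : H' ≃* H := MulEquiv.ofBijective (conjHom g eH) (conjHom_bijective g eH)
  have ha : pullback K (conjHom g eL) x = ind K a.symm.toMonoidHom x := (ind_equiv a.symm x).symm
  have hb : ∀ y, pullback K (conjHom g eH) y = ind K b.symm.toMonoidHom y :=
    fun y => (ind_equiv b.symm y).symm
  rw [ha, hb, ind_ind, ind_ind]
  refine congrArg (fun φ : L →* H' => ind K φ x) (MonoidHom.ext fun y => ?_)
  obtain ⟨y, rfl⟩ := a.surjective y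
  change Subgroup.inclusion hL' (a.symm (a y)) = b.symm (Subgroup.inclusion hL (a y))
  rw [a.symm_apply_apply, eq_comm, b.symm_apply_eq]
  rfl

theorem pullback_ind_subgroup {J L H : Subgroup G} (hJ : J ≤ H) (hL : L ≤ H)
    (r : DoubleCoset.Quotient (J.subgroupOf H : Set H) (L.subgroupOf H : Set H) → H)
    (hr : ∀ q, DoubleCoset.mk (J.subgroupOf H) (L.subgroupOf H) (r q) = q) (y : CharRing K L) :
    pullback K (Subgroup.inclusion hJ) (ind K (Subgroup.inclusion hL) y) =
      ∑ᶠ q, ind K (Subgroup.inclusion (inf_le_left : J ⊓ conjSubgroup (r q : G) L ≤ J))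
        (pullback K (conjHom (r q : G) (inf_conj_eq (r q : G) J L))
          (pullback K (Subgroup.inclusion (inf_le_right : conjSubgroup (r q : G)⁻¹ J ⊓ L ≤ L))
            y)) := by
  simp only [pullback_pullback]
  refine pullback_ind _ _ (J.subgroupOf H) (L.subgroupOf H) (Subgroup.inclusion_range hJ)
    (Subgroup.inclusion_range hL) r hr _ _ _ (fun q d => ?_) (fun q a b h => ?_) y
  · refine Subtype.ext ?_
    change d.1 = (r q : G) * (conjHom (r q : G) (inf_conj_eq (r q : G) J L) d : G) * (r q : G)⁻¹
    rw [coe_conjHom]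
    group
  · have h : (a : G) = (r q : G) * b * (r q : G)⁻¹ := congrArg Subtype.val h
    -- The fibre product is realised by J ∩ ʳL itself: a pair (a, b) with a = r b r⁻¹ corresponds to
    -- the element a.
    refine ⟨⟨a.1, a.2, b.1, b.2, h.symm⟩, ⟨rfl, Subtype.ext ?_⟩, ?_⟩
    · change (conjHom (r q : G) (inf_conj_eq (r q : G) J L) _ : G) = b
      rw [coe_conjHom]
      simp only [h]
      group
    · rintro d ⟨rfl, -⟩
      rfl

theorem gradedInd_gradedPullback_conjHom (g : G) {L H L' H' : Subgroup G} (hL : L ≤ H)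
    (hL' : L' ≤ H') (eL : L' = conjSubgroup g L) (eH : H' = conjSubgroup g H)
    (x : SatGraded K L) :
    gradedInd K (Subgroup.inclusion hL') (Subgroup.inclusion_injective hL')
        (gradedPullback K (conjHom g eL) x) =
      gradedPullback K (conjHom g eH)
        (gradedInd K (Subgroup.inclusion hL) (Subgroup.inclusion_injective hL) x) := by
  rw [gradedInd, gradedInd, gradedPullback, gradedPullback, gradedMap_gradedMap,
    gradedMap_gradedMap]
  exact gradedMap_congr _ _ (ind_pullback_conjHom g hL hL' eL eH) x

theorem gradedPullback_gradedInd_subgroup {J L H : Subgroup G} (hJ : J ≤ H) (hL : L ≤ H)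
    (r : DoubleCoset.Quotient (J.subgroupOf H : Set H) (L.subgroupOf H : Set H) → H)
    (hr : ∀ q, DoubleCoset.mk (J.subgroupOf H) (L.subgroupOf H) (r q) = q) (y : SatGraded K L) :
    gradedPullback K (Subgroup.inclusion hJ)
        (gradedInd K (Subgroup.inclusion hL) (Subgroup.inclusion_injective hL) y) =
      ∑ᶠ q, gradedInd K (Subgroup.inclusion (inf_le_left : J ⊓ conjSubgroup (r q : G) L ≤ J))
        (Subgroup.inclusion_injective inf_le_left)
        (gradedPullback K (conjHom (r q : G) (inf_conj_eq (r q : G) J L))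
          (gradedPullback K
            (Subgroup.inclusion (inf_le_right : conjSubgroup (r q : G)⁻¹ J ⊓ L ≤ L)) y)) := by
  have : Finite (DoubleCoset.Quotient (J.subgroupOf H : Set H) (L.subgroupOf H : Set H)) :=
    Finite.of_surjective (DoubleCoset.mk (J.subgroupOf H) (L.subgroupOf H))
      fun q => ⟨r q, hr q⟩
  simp only [gradedPullback_gradedPullback]
  exact gradedPullback_gradedInd _ _ _ (fun _ => Subgroup.inclusion_injective inf_le_left) _
    (pullback_ind_subgroup hJ hL r hr) y

theorem gradedPullback_conjHom_self (H : Subgroup G) {h : G} (hh : h ∈ H)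
    (e : H = conjSubgroup h H) (x : SatGraded K H) : gradedPullback K (conjHom h e) x = x :=
  gradedMap_eq_self _ (fun x => Subtype.ext <| funext fun y =>
    -- The inverse appears because `conjHom h` sends y to h⁻¹yh.
    charRing_conj x (⟨h, hh⟩⁻¹ : H) y) x

theorem gradedPullback_conjHom_conjHom (g h : G) {H H' H'' : Subgroup G}
    (e' : H' = conjSubgroup h H) (e'' : H'' = conjSubgroup g H')
    (e : H'' = conjSubgroup (g * h) H) (x : SatGraded K H) :
    gradedPullback K (conjHom g e'') (gradedPullback K (conjHom h e') x) =
      gradedPullback K (conjHom (g * h) e) x :=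
  (gradedMap_gradedMap _ _ _ _ x).trans
    (gradedMap_congr _ _ (pullback_conjHom_conjHom g h e' e'' e) x)

/-- The Mackey functor of saturated graded rings. -/
noncomputable def satMackey (K : Type u) [Field K] [CharZero K] (G : Type v) [Group G] [Finite G] :
    MackeyFunctor ℤ G fun H => SatGraded K H where
  res h := (gradedPullback K (Subgroup.inclusion h)).toIntLinearMap
  ind h := (gradedInd K (Subgroup.inclusion h) (Subgroup.inclusion_injective h)).toIntLinearMap
  conj g _ _ e := (gradedPullback K (conjHom g e)).toIntLinearMap
  res_self _ x := gradedPullback_id x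
  ind_self _ x := gradedInd_id x
  conj_self H _ hh e x := gradedPullback_conjHom_self H hh e x
  res_res hJ hL x := gradedPullback_gradedPullback (Subgroup.inclusion hJ)
    (Subgroup.inclusion hL) x
  ind_ind hJ hL x := gradedInd_gradedInd (Subgroup.inclusion_injective hJ)
    (Subgroup.inclusion_injective hL) x
  conj_conj g h _ _ _ e' e'' e x := gradedPullback_conjHom_conjHom g h e' e'' e x
  res_conj g _ _ _ _ hL hL' eL eH x :=
    (gradedPullback_gradedPullback (Subgroup.inclusion hL') (conjHom g eH) x).trans
      (gradedPullback_gradedPullback (conjHom g eL) (Subgroup.inclusion hL) x).symm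
  ind_conj g _ _ _ _ hL hL' eL eH x := gradedInd_gradedPullback_conjHom g hL hL' eL eH x
  res_ind hJ hL r hr y := gradedPullback_gradedInd_subgroup hJ hL r hr y

end Graded

end SaturatedRing

/-- Homogeneous classes generate the graded groups, so the formulas on classes determine `mul` and
the three operations of `M` uniquely. -/
theorem mainTheorem3 {K : Type*} [Field K] [CharZero K] {G : Type*} [Group G] [Finite G] :
    (∀ H : Subgroup G,
      SaturatedRing.satFiltration K H 0 = ⊤ ∧
      (∀ n, SaturatedRing.satFiltration K H (n + 1) ≤ SaturatedRing.satFiltration K H n) ∧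
      ∃ mul : SaturatedRing.SatGraded K H →+ SaturatedRing.SatGraded K H →+
          SaturatedRing.SatGraded K H,
        ∀ (m n : ℕ) (x : SaturatedRing.satFiltration K H m) (y : SaturatedRing.satFiltration K H n),
          ∃ hxy : x.1 * y.1 ∈ SaturatedRing.satFiltration K H (m + n),
            mul (SaturatedRing.gradedClass K H m x) (SaturatedRing.gradedClass K H n y) =
              SaturatedRing.gradedClass K H (m + n) ⟨_, hxy⟩) ∧
    ∃ M : SaturatedRing.MackeyFunctor ℤ G (fun H => SaturatedRing.SatGraded K H),
      (∀ {L H : Subgroup G} (h : L ≤ H) (n : ℕ) (x : SaturatedRing.satFiltration K H n),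
        ∃ hx : SaturatedRing.pullback K (Subgroup.inclusion h) x.1 ∈
            SaturatedRing.satFiltration K L n,
          M.res h (SaturatedRing.gradedClass K H n x) = SaturatedRing.gradedClass K L n ⟨_, hx⟩) ∧
      (∀ {L H : Subgroup G} (h : L ≤ H) (n : ℕ) (x : SaturatedRing.satFiltration K L n),
        ∃ hx : SaturatedRing.ind K (Subgroup.inclusion h) x.1 ∈
            SaturatedRing.satFiltration K H n,
          M.ind h (SaturatedRing.gradedClass K L n x) = SaturatedRing.gradedClass K H n ⟨_, hx⟩) ∧
      (∀ (g : G) {H H' : Subgroup G} (e : H' = SaturatedRing.conjSubgroup g H) (n : ℕ)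
        (x : SaturatedRing.satFiltration K H n),
        ∃ hx : SaturatedRing.pullback K (SaturatedRing.conjHom g e) x.1 ∈
            SaturatedRing.satFiltration K H' n,
          M.conj g e (SaturatedRing.gradedClass K H n x) =
            SaturatedRing.gradedClass K H' n ⟨_, hx⟩) := by
  exact ⟨fun H => ⟨SaturatedRing.satFiltration_zero,
      fun n => SaturatedRing.satFiltration_anti n.le_succ, SaturatedRing.gradedMul K H,
      fun m n x y => ⟨_, SaturatedRing.gradedMul_gradedClass m n x y⟩⟩,
    SaturatedRing.satMackey K G,
    fun h _ x => ⟨SaturatedRing.pullback_mem_satFiltration (Subgroup.inclusion h) x.2,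
      SaturatedRing.gradedMap_gradedClass _ _ _ _⟩,
    fun h _ x => ⟨SaturatedRing.ind_mem_satFiltration (Subgroup.inclusion_injective h) x.2,
      SaturatedRing.gradedMap_gradedClass _ _ _ _⟩,
    fun g _ _ e _ x => ⟨SaturatedRing.pullback_mem_satFiltration (SaturatedRing.conjHom g e) x.2,
      SaturatedRing.gradedMap_gradedClass _ _ _ _⟩⟩
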